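/- Let $\ell$ be a prime and let $G$ be a finite group with a normal $\ell$-Sylow subgroup $N$ and a complement $H$, so $G = N\rtimes H$ with $(|H|,\ell)=1$. Let $t$ be the rank (minimal number of generators) of $N$, let ${\rm fr}(N)$ be the subgroup of $N$ generated by $\ell$-th powers and commutators, and identify $N/{\rm fr}(N)$ with $(\mathbb Z/\ell)^t$, so that there is a canonical surjection $\pi: G\to (\mathbb Z/\ell)^t\rtimes H$ that is the identity on $H$. A continuous surjection $\psi:E\to G$ from a profinite group is an $\ell$-Frattini cover if its kernel is pro-$\ell$ and no proper closed subgroup of $E$ maps onto $G$; it is the universal $\ell$-Frattini cover of $G$ if moreover it factors through every $\ell$-Frattini cover of $G$ (that is, for every $\ell$-Frattini cover $\chi:F\to G$ there is a continuous homomorphism $\theta:E\to F$ with $\chi\circ\theta=\psi$). The universal $\ell$-Frattini cover $\psi:{}_\ell\tilde G\to G$ exists. Write $\ker_0=\ker\psi$, let ${}_\ell M_G$ be the $\mathbb Z/\ell[G]$-module obtained from $\ker_0$ by dividing out the closed subgroup generated by $\ell$-th powers and commutators of elements of $\ker_0$, and let ${}_\ell\tilde\psi_{\rm ab}:{}_\ell\tilde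 G_{\rm ab}={}_\ell\tilde G/\overline{[\ker_0,\ker_0]}\to G$ be the abelianized cover. Then: (1) There is an action of $H$ on $(\mathbb Z/\ell^2)^t$ that lifts the action on $(\mathbb Z/\ell)^t$, such that the reduction map $\mu:(\mathbb Z/\ell^2)^t\rtimes H\to(\mathbb Z/\ell)^t\rtimes H$ is a Frattini cover (no proper subgroup maps onto the target) and $\mu'=\pi\circ\psi$ factors as $\mu\circ\theta$ with a continuous surjection $\theta:{}_\ell\tilde G\to(\mathbb Z/\ell^2)^t\rtimes H$. (2) Let $M'=\ker(\mu)\cong(\mathbb Z/\ell)^t$, a $\mathbb Z/\ell[G]$-module on which $G$ acts by conjugation through $\pi$. There is a surjective homomorphism $f:{}_\ell M_G\to M'$ of $\mathbb Z/\ell[G]$-modules. (3) There is a lattice quotient of ${}_\ell\tilde\psi_{\rm ab}$ with kernel $\mathbb Z_\ell^t$ that belongs to $M'$: an $\ell$-Frattini cover $\psi^\star:G^\star\to G$ whose kernel $L$ is isomorphic to $\mathbb Z_\ell^t$ as a topological group, and a continuous surjection $\nu:{}_\ell\tilde G_{\rm ab}\to G^\star$ with $\psi^\star\circ\nu={}_\ell\tilde\psi_{\rm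 ab}$, such that $\ell^kL/\ell^{k+1}L\cong M'$ as $\mathbb Z/\ell[G]$-modules for all $k\ge0$ and, for a suitable choice of this isomorphism for $k=0$, the map ${}_\ell M_G\to L/\ell L\cong M'$ induced by $\nu$ is $f$. -/

import Mathlib

universe u v

namespace LFrattini

open scoped commutatorElement

theorem normal_closure_of_conj_mem {A : Type u} [Group A] {S : Set A}
    (hS : ∀ g : A, ∀ x ∈ S, g * x * g⁻¹ ∈ S) : (Subgroup.closure S).Normal where
  conj_mem x hx g := by
    induction hx using Subgroup.closure_induction with
    | mem x hx => exact Subgroup.subset_closure (hS g x hx)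
    | one => simp
    | mul x y _ _ hx hy => simpa [mul_assoc] using mul_mem hx hy
    | inv x _ hx => simpa [mul_assoc] using inv_mem hx

/-! ### Elementary abelian sections of a group as modules -/

section Sections

variable {A : Type u} {B : Type v} [Group A] [Group B]

/-- The quotient `K / D` of two normal subgroups of `A` is an abelian group killed by `ℓ`
on which the kernel of the surjection `p : A → B` acts trivially by conjugation. So `K / D`
is a `ℤ/ℓ[B]`-module, `b = p a` acting as conjugation by `a`. -/
structure IsElemSection (ℓ : ℕ) (p : A →* B) (K D : Subgroup A) : Prop where
  surj : Function.Surjective p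
  K_normal : K.Normal
  D_normal : D.Normal
  pow_mem : ∀ x ∈ K, x ^ ℓ ∈ D
  comm_mem : ∀ x ∈ K, ∀ y ∈ K, ⁅x, y⁆ ∈ D
  triv_mem : ∀ a ∈ p.ker, ∀ x ∈ K, ⁅a, x⁆ ∈ D

variable {ℓ : ℕ} {p : A →* B} {K D : Subgroup A}

theorem IsElemSection.normal_subgroupOf (h : IsElemSection ℓ p K D) :
    (D.subgroupOf K).Normal := by
  have := h.D_normal
  infer_instance

/-- The section `K / D`, written additively. -/
def SectionModule (_h : IsElemSection ℓ p K D) : Type u :=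
  Additive (K ⧸ D.subgroupOf K)

/-- The class in `K / D` of an element of `K`. -/
def SectionModule.mk (h : IsElemSection ℓ p K D) (x : K) : SectionModule h :=
  Additive.ofMul (QuotientGroup.mk x : K ⧸ D.subgroupOf K)

instance (h : IsElemSection ℓ p K D) : AddCommGroup (SectionModule h) :=
  haveI := h.normal_subgroupOf
  { (inferInstance : AddGroup (Additive (K ⧸ D.subgroupOf K))) with
    add_comm := by
      intro x y
      induction x using QuotientGroup.induction_on with | H x => ?_
      induction y using QuotientGroup.induction_on with | H y => ?_
      refine (QuotientGroup.eq (s := D.subgroupOf K)).2 ?_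
      have := h.comm_mem _ (K.inv_mem y.2) _ (K.inv_mem x.2)
      rw [Subgroup.mem_subgroupOf]
      simpa [commutatorElement_def, mul_assoc] using this }

theorem SectionModule.nsmul_eq_zero (h : IsElemSection ℓ p K D) (x : SectionModule h) :
    ℓ • x = 0 := by
  have := h.normal_subgroupOf
  induction x using QuotientGroup.induction_on with | H x => ?_
  refine (QuotientGroup.eq_one_iff (N := D.subgroupOf K) (x ^ ℓ)).2 ?_
  rw [Subgroup.mem_subgroupOf]
  simpa using h.pow_mem _ x.2

instance (h : IsElemSection ℓ p K D) : Module (ZMod ℓ) (SectionModule h) :=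
  AddCommGroup.zmodModule (SectionModule.nsmul_eq_zero h)

/-- Conjugation by `a : A` on `K / D`. -/
def sectionConj (h : IsElemSection ℓ p K D) (a : A) : SectionModule h →+ SectionModule h :=
  haveI := h.normal_subgroupOf
  haveI := h.K_normal
  MonoidHom.toAdditive
    (QuotientGroup.map (D.subgroupOf K) (D.subgroupOf K) (MulAut.conjNormal a).toMonoidHom (by
      intro x hx
      rw [Subgroup.mem_subgroupOf] at hx
      simpa [Subgroup.mem_comap, Subgroup.mem_subgroupOf] using h.D_normal.conj_mem _ hx a))

theorem sectionConj_mk (h : IsElemSection ℓ p K D) (a : A) (x : K) :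
    sectionConj h a (SectionModule.mk h x) =
      SectionModule.mk h ⟨a * x * a⁻¹, h.K_normal.conj_mem _ x.2 a⟩ := by
  have := h.normal_subgroupOf
  have := h.K_normal
  refine congrArg (fun z : K => SectionModule.mk h z) ?_
  ext
  simp

theorem SectionModule.exists_mk (h : IsElemSection ℓ p K D) (x : SectionModule h) :
    ∃ y, SectionModule.mk h y = x := by
  induction x using QuotientGroup.induction_on with | H x => exact ⟨x, rfl⟩

/-- Conjugation, as a representation of `A` on `K / D`. -/
def sectionConjHom (h : IsElemSection ℓ p K D) :
    Representation (ZMod ℓ) A (SectionModule h) where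
  toFun a := (sectionConj h a).toZModLinearMap ℓ
  map_one' := by
    ext x
    obtain ⟨y, rfl⟩ := SectionModule.exists_mk h x
    simp [sectionConj_mk]
  map_mul' a b := by
    ext x
    obtain ⟨y, rfl⟩ := SectionModule.exists_mk h x
    simp [sectionConj_mk, mul_assoc]

theorem sectionConjHom_eq (h : IsElemSection ℓ p K D) {a b : A} (hab : p a = p b) :
    sectionConjHom h a = sectionConjHom h b := by
  have := h.normal_subgroupOf
  ext x
  obtain ⟨y, rfl⟩ := SectionModule.exists_mk h x
  change sectionConj h a _ = sectionConj h b _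
  rw [sectionConj_mk, sectionConj_mk]
  refine (QuotientGroup.eq (s := D.subgroupOf K)).2 ?_
  rw [Subgroup.mem_subgroupOf]
  have hk : b⁻¹ * a ∈ p.ker := by simp [MonoidHom.mem_ker, hab]
  simpa [commutatorElement_def, mul_assoc] using
    h.D_normal.conj_mem _ (h.triv_mem _ hk _ (K.inv_mem y.2)) b

/-- The `ℤ/ℓ[B]`-module `K / D`: `b` acts as conjugation by any preimage of `b` in `A`. -/
noncomputable def sectionRep (h : IsElemSection ℓ p K D) :
    Representation (ZMod ℓ) B (SectionModule h) where
  toFun b := sectionConjHom h (Function.surjInv h.surj b)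
  map_one' := by
    rw [← map_one (sectionConjHom h)]
    exact sectionConjHom_eq h (by simp [Function.surjInv_eq])
  map_mul' b c := by
    rw [← map_mul (sectionConjHom h)]
    exact sectionConjHom_eq h (by simp [Function.surjInv_eq])

theorem sectionRep_mk (h : IsElemSection ℓ p K D) (a : A) (x : K) :
    sectionRep h (p a) (SectionModule.mk h x) =
      SectionModule.mk h ⟨a * x * a⁻¹, h.K_normal.conj_mem _ x.2 a⟩ := by
  rw [← sectionConj_mk]
  exact LinearMap.congr_fun
    (sectionConjHom_eq h (Function.surjInv_eq h.surj (p a))) (SectionModule.mk h x)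

end Sections

/-! ### Frattini covers -/

/-- Frattini covers of abstract (in particular, finite) groups. -/
structure IsFrattiniCover {A : Type u} {B : Type v} [Group A] [Group B] (p : A →* B) : Prop where
  surjective : Function.Surjective p
  eq_top : ∀ K : Subgroup A, K.map p = ⊤ → K = ⊤

/-- A (compact) topological group is pro-`ℓ` if all its quotients by open normal subgroups
are `ℓ`-groups. -/
def IsProLGroup (ℓ : ℕ) (A : Type u) [Group A] [TopologicalSpace A] : Prop :=
  ∀ U : OpenNormalSubgroup A, IsPGroup ℓ (A ⧸ U.toSubgroup)

/-- `ℓ`-Frattini covers of profinite groups: continuous surjections with pro-`ℓ` kernel, for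
which no proper closed subgroup maps onto the target. -/
structure IsLFrattiniCover (ℓ : ℕ) {A : Type u} {B : Type v} [Group A] [TopologicalSpace A]
    [Group B] [TopologicalSpace B] (p : A →ₜ* B) : Prop where
  surjective : Function.Surjective p
  eq_top : ∀ K : Subgroup A, IsClosed (K : Set A) → K.map p.toMonoidHom = ⊤ → K = ⊤
  ker_isProL : IsProLGroup ℓ p.toMonoidHom.ker

/-- The universal `ℓ`-Frattini cover of `G`: an `ℓ`-Frattini cover of `G` by a profinite group
through which every `ℓ`-Frattini cover of `G` by a profinite group factors. -/
structure IsUniversalLFrattiniCover (ℓ : ℕ) {G : Type u} [Group G] [TopologicalSpace G]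
    {E : ProfiniteGrp.{u}} (ψ : E →ₜ* G) : Prop where
  isLFrattiniCover : IsLFrattiniCover ℓ ψ
  exists_factor : ∀ (F : ProfiniteGrp.{u}) (χ : F →ₜ* G), IsLFrattiniCover ℓ χ →
    ∃ θ : E →ₜ* F, χ.comp θ = ψ

/-! ### The characteristic module and the abelianized cover -/

section Char

variable {A : Type u} [Group A] [TopologicalSpace A] [IsTopologicalGroup A]

/-- For a subgroup `K`, the closed subgroup generated by the `ℓ`-th powers and the commutators
of elements of `K`; for `K` a pro-`ℓ` group this is its Frattini subgroup. -/
def frattiniSubgroup (ℓ : ℕ) (K : Subgroup A) : Subgroup A :=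
  (Subgroup.closure ({z | ∃ x ∈ K, x ^ ℓ = z} ∪
    {z | ∃ x ∈ K, ∃ y ∈ K, ⁅x, y⁆ = z})).topologicalClosure

theorem frattiniSubgroup_normal (ℓ : ℕ) (K : Subgroup A) [hK : K.Normal] :
    (frattiniSubgroup ℓ K).Normal := by
  have : (Subgroup.closure ({z | ∃ x ∈ K, x ^ ℓ = z} ∪
      {z | ∃ x ∈ K, ∃ y ∈ K, ⁅x, y⁆ = z})).Normal := by
    refine normal_closure_of_conj_mem ?_
    rintro g _ (⟨x, hx, rfl⟩ | ⟨x, hx, y, hy, rfl⟩)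
    · exact Or.inl ⟨g * x * g⁻¹, hK.conj_mem _ hx g, by simp [conj_pow]⟩
    · exact Or.inr ⟨g * x * g⁻¹, hK.conj_mem _ hx g, g * y * g⁻¹, hK.conj_mem _ hy g,
        by simp [commutatorElement_def, mul_assoc]⟩
  exact Subgroup.is_normal_topologicalClosure _

variable {G : Type v} [Group G] [TopologicalSpace G]

theorem charSection (ℓ : ℕ) (ψ : A →ₜ* G) (hψ : Function.Surjective ψ) :
    IsElemSection ℓ ψ.toMonoidHom ψ.toMonoidHom.ker
      (frattiniSubgroup ℓ ψ.toMonoidHom.ker) where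
  surj := hψ
  K_normal := inferInstance
  D_normal := frattiniSubgroup_normal ℓ _
  pow_mem x hx := Subgroup.le_topologicalClosure _ (Subgroup.subset_closure (Or.inl ⟨x, hx, rfl⟩))
  comm_mem x hx y hy := Subgroup.le_topologicalClosure _
    (Subgroup.subset_closure (Or.inr ⟨x, hx, y, hy, rfl⟩))
  triv_mem x hx y hy := Subgroup.le_topologicalClosure _
    (Subgroup.subset_closure (Or.inr ⟨x, hx, y, hy, rfl⟩))

/-- For `ψ` the universal `ℓ`-Frattini cover of `G`, the characteristic `ℤ/ℓ[G]`-module of `G`: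
the kernel of `ψ` modulo its Frattini subgroup. -/
noncomputable def charRep (ℓ : ℕ) (ψ : A →ₜ* G) (hψ : Function.Surjective ψ) :
    Representation (ZMod ℓ) G (SectionModule (charSection ℓ ψ hψ)) :=
  sectionRep (charSection ℓ ψ hψ)

/-- The closed commutator subgroup of the kernel of a cover. -/
def kerCommutator (ψ : A →ₜ* G) : Subgroup A :=
  (⁅ψ.toMonoidHom.ker, ψ.toMonoidHom.ker⁆ : Subgroup A).topologicalClosure

instance (ψ : A →ₜ* G) : (kerCommutator ψ).Normal :=
  Subgroup.is_normal_topologicalClosure _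

/-- The covering group of the abelianized cover attached to `ψ`. -/
abbrev AbCover (ψ : A →ₜ* G) : Type u := A ⧸ kerCommutator ψ

end Char

/-! ### Lattice kernels -/

section Lattice

variable {A : Type u} {B : Type v} [Group A] [Group B]

/-- The subgroup generated by the `n`-th powers of elements of the kernel of `p`. If the kernel
`L` is abelian, this is the subgroup `n L` of all `n`-th powers. -/
def kerPow (p : A →* B) (n : ℕ) : Subgroup A :=
  Subgroup.closure {z | ∃ x ∈ p.ker, x ^ n = z}

theorem kerPow_normal (p : A →* B) (n : ℕ) : (kerPow p n).Normal := by
  refine normal_closure_of_conj_mem ?_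
  rintro g _ ⟨x, hx, rfl⟩
  exact ⟨g * x * g⁻¹, p.normal_ker.conj_mem _ hx g, by simp [conj_pow]⟩

theorem kerPow_le (p : A →* B) (n : ℕ) : kerPow p n ≤ p.ker := by
  refine (Subgroup.closure_le _).2 ?_
  rintro _ ⟨x, hx, rfl⟩
  exact p.ker.pow_mem hx n

theorem exists_pow_of_mem_kerPow {p : A →* B}
    (hc : ∀ x ∈ p.ker, ∀ y ∈ p.ker, x * y = y * x) {n : ℕ} {z : A} (hz : z ∈ kerPow p n) :
    ∃ x ∈ p.ker, x ^ n = z := by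
  induction hz using Subgroup.closure_induction with
  | mem x hx => exact hx
  | one => exact ⟨1, one_mem _, one_pow n⟩
  | mul x y _ _ hx hy =>
    obtain ⟨a, ha, rfl⟩ := hx
    obtain ⟨b, hb, rfl⟩ := hy
    exact ⟨a * b, mul_mem ha hb, Commute.mul_pow (hc a ha b hb) n⟩
  | inv x _ hx =>
    obtain ⟨a, ha, rfl⟩ := hx
    exact ⟨a⁻¹, inv_mem ha, inv_pow a n⟩

/-- If the kernel `L` of the surjection `p : A → B` is abelian, `ℓ ^ k L / ℓ ^ (k + 1) L` is a
`ℤ/ℓ[B]`-module. -/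
theorem latticeSection (ℓ : ℕ) {p : A →* B} (hp : Function.Surjective p)
    (hc : ∀ x ∈ p.ker, ∀ y ∈ p.ker, x * y = y * x) (k : ℕ) :
    IsElemSection ℓ p (kerPow p (ℓ ^ k)) (kerPow p (ℓ ^ (k + 1))) where
  surj := hp
  K_normal := kerPow_normal p _
  D_normal := kerPow_normal p _
  pow_mem x hx := by
    obtain ⟨y, hy, rfl⟩ := exists_pow_of_mem_kerPow hc hx
    exact Subgroup.subset_closure ⟨y, hy, by rw [← pow_mul, ← pow_succ]⟩
  comm_mem x hx y hy := by
    rw [commutatorElement_eq_one_iff_mul_comm.2 (hc x (kerPow_le p _ hx) y (kerPow_le p _ hy))]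
    exact one_mem _
  triv_mem x hx y hy := by
    rw [commutatorElement_eq_one_iff_mul_comm.2 (hc x hx y (kerPow_le p _ hy))]
    exact one_mem _

theorem mem_kerPow_pow_zero {p : A →* B} (ℓ : ℕ) {x : A} (hx : x ∈ p.ker) :
    x ∈ kerPow p (ℓ ^ 0) :=
  Subgroup.subset_closure ⟨x, hx, by simp⟩

end Lattice

/-! ### The semidirect products `(ℤ/n)^t ⋊ H` -/

section Semidirect

/-- The group `(ℤ/n)^t`, written multiplicatively. -/
abbrev ZPow (n t : ℕ) : Type := Multiplicative (Fin t → ZMod n)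

/-- The coordinatewise reduction `(ℤ/ℓ²)^t → (ℤ/ℓ)^t`. -/
def redHom (ℓ t : ℕ) : ZPow (ℓ ^ 2) t →* ZPow ℓ t :=
  AddMonoidHom.toMultiplicative
    { toFun := fun v i => ZMod.castHom (dvd_pow_self ℓ two_ne_zero) (ZMod ℓ) (v i)
      map_zero' := by ext i; simp
      map_add' := by intro v w; ext i; simp }

variable {ℓ t : ℕ} {H : Type u} [Group H]
  {φ₂ : H →* MulAut (ZPow (ℓ ^ 2) t)} {φ₁ : H →* MulAut (ZPow ℓ t)}

/-- The homomorphism `(ℤ/ℓ²)^t ⋊ H → (ℤ/ℓ)^t ⋊ H` that is reduction modulo `ℓ` on the first factor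
and the identity on `H`, for an action `φ₂` of `H` that reduces to `φ₁`. -/
def redMap (h : ∀ g v, redHom ℓ t (φ₂ g v) = φ₁ g (redHom ℓ t v)) :
    ZPow (ℓ ^ 2) t ⋊[φ₂] H →* ZPow ℓ t ⋊[φ₁] H :=
  SemidirectProduct.map (redHom ℓ t) (MonoidHom.id H) (fun g => MonoidHom.ext (h g))

theorem redHom_surjective (ℓ t : ℕ) : Function.Surjective (redHom ℓ t) := by
  intro w
  have hs := ZMod.castHom_surjective (dvd_pow_self ℓ two_ne_zero : ℓ ∣ ℓ ^ 2)
  choose s hs using hs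
  exact ⟨Multiplicative.ofAdd (fun i => s (Multiplicative.toAdd w i)), by
    apply Multiplicative.toAdd.injective
    funext i
    exact hs _⟩

theorem redHom_pow (ℓ t : ℕ) (v : ZPow (ℓ ^ 2) t) (hv : redHom ℓ t v = 1) : v ^ ℓ = 1 := by
  apply Multiplicative.toAdd.injective
  funext i
  have h0 : ZMod.castHom (dvd_pow_self ℓ two_ne_zero) (ZMod ℓ) (Multiplicative.toAdd v i) = 0 :=
    congrFun (congrArg Multiplicative.toAdd hv) i
  change ℓ • (Multiplicative.toAdd v i) = 0
  obtain ⟨z, hz⟩ := ZMod.intCast_surjective (Multiplicative.toAdd v i)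
  rw [← hz, map_intCast, ZMod.intCast_zmod_eq_zero_iff_dvd] at h0
  obtain ⟨c, rfl⟩ := h0
  rw [← hz, nsmul_eq_mul]
  have h1 : ((ℓ ^ 2 : ℕ) : ZMod (ℓ ^ 2)) = 0 := ZMod.natCast_self _
  push_cast at h1 ⊢
  rw [← mul_assoc, ← pow_two, h1, zero_mul]

theorem redMap_ker (h : ∀ g v, redHom ℓ t (φ₂ g v) = φ₁ g (redHom ℓ t v))
    {x : ZPow (ℓ ^ 2) t ⋊[φ₂] H} (hx : x ∈ (redMap h).ker) :
    ∃ v, redHom ℓ t v = 1 ∧ x = SemidirectProduct.inl v := by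
  have h1 := congrArg SemidirectProduct.left (MonoidHom.mem_ker.1 hx)
  have h2 := congrArg SemidirectProduct.right (MonoidHom.mem_ker.1 hx)
  refine ⟨x.left, h1, ?_⟩
  ext1
  · rfl
  · exact h2

/-- The kernel of `redMap` is a `ℤ/ℓ[(ℤ/ℓ)^t ⋊ H]`-module. -/
theorem redSection (h : ∀ g v, redHom ℓ t (φ₂ g v) = φ₁ g (redHom ℓ t v)) :
    IsElemSection ℓ (redMap h) (redMap h).ker ⊥ where
  surj x := by
    obtain ⟨v, hv⟩ := redHom_surjective ℓ t x.left
    refine ⟨⟨v, x.right⟩, ?_⟩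
    ext1
    · exact hv
    · rfl
  K_normal := inferInstance
  D_normal := inferInstance
  pow_mem x hx := by
    obtain ⟨v, hv, rfl⟩ := redMap_ker h hx
    rw [Subgroup.mem_bot, ← map_pow, redHom_pow ℓ t v hv, map_one]
  comm_mem x hx y hy := by
    obtain ⟨v, hv, rfl⟩ := redMap_ker h hx
    obtain ⟨w, hw, rfl⟩ := redMap_ker h hy
    rw [Subgroup.mem_bot, commutatorElement_eq_one_iff_mul_comm, ← map_mul, ← map_mul, mul_comm]
  triv_mem x hx y hy := by
    obtain ⟨v, hv, rfl⟩ := redMap_ker h hx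
    obtain ⟨w, hw, rfl⟩ := redMap_ker h hy
    rw [Subgroup.mem_bot, commutatorElement_eq_one_iff_mul_comm, ← map_mul, ← map_mul, mul_comm]

/-- `π` is the canonical map `G = N ⋊ H → N' ⋊ H`, where `N' = N / fr(N)` is the quotient of the
`ℓ`-group `N` by its Frattini subgroup and is identified with `(ℤ/ℓ)^t`. -/
structure IsFrattiniQuotientMap {G : Type u} [Group G] [TopologicalSpace G]
    [IsTopologicalGroup G] (N H : Subgroup G) {φ₁ : H →* MulAut (ZPow ℓ t)}
    (π : G →* ZPow ℓ t ⋊[φ₁] H) : Prop where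
  surjective : Function.Surjective π
  ker_eq : π.ker = frattiniSubgroup ℓ N
  map_N : ∀ n ∈ N, (π n).right = 1
  map_H : ∀ h : H, π h = SemidirectProduct.inr h

end Semidirect

end LFrattini

/-! The action of `H` on `(ℤ/ℓ)^t` lifts to `ℤ_ℓ^t` because `|H|` is prime to `ℓ`, and
`ℤ_ℓ^t ⋊ H → (ℤ/ℓ)^t ⋊ H` is an `ℓ`-Frattini cover. Its pullback along `π : G → (ℤ/ℓ)^t ⋊ H` maps
onto `G` with kernel `ℤ_ℓ^t`, and a minimal closed subgroup of the pullback that still maps onto `G`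
is an `ℓ`-Frattini cover `G⋆ → G`, whose kernel is an `H`-stable sublattice of finite index in
`ℤ_ℓ^t`. All such lattices have isomorphic reductions modulo `ℓ`, since `ℤ/ℓ[H]` is semisimple. The
universal `ℓ`-Frattini cover factors through `G⋆`, and hence through `(ℤ/ℓ²)^t ⋊ H`. -/

universe w

namespace LFrattini

open scoped commutatorElement
open Filter Topology

section Sections

variable {A : Type u} {B : Type v} [Group A] [Group B] {ℓ : ℕ} {p : A →* B} {K D : Subgroup A}

theorem SectionModule.mk_mul (h : IsElemSection ℓ p K D) (x y : K) :
    SectionModule.mk h (x * y) = SectionModule.mk h x + SectionModule.mk h y := rfl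

theorem SectionModule.mk_eq_zero_iff (h : IsElemSection ℓ p K D) (x : K) :
    SectionModule.mk h x = 0 ↔ (x : A) ∈ D := by
  have := h.normal_subgroupOf
  exact (QuotientGroup.eq_one_iff (N := D.subgroupOf K) x).trans Subgroup.mem_subgroupOf

theorem exists_sectionRep_intertwiningMap (h : IsElemSection ℓ p K D) {A' : Type w} [Group A']
    {p' : A' →* B} {K' D' : Subgroup A'} (h' : IsElemSection ℓ p' K' D') (θ : A →* A')
    (hθ : p'.comp θ = p) (hK : K ≤ K'.comap θ) (hD : D ≤ D'.comap θ) :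
    ∃ f : Representation.IntertwiningMap (sectionRep h) (sectionRep h'),
      ∀ x : K, f (SectionModule.mk h x) = SectionModule.mk h' ⟨θ x, hK x.2⟩ := by
  have := h.normal_subgroupOf
  have := h'.normal_subgroupOf
  let θK : K →* K' := (θ.comp K.subtype).codRestrict K' fun x => hK x.2
  let f₀ : SectionModule h →+ SectionModule h' :=
    MonoidHom.toAdditive (QuotientGroup.map (D.subgroupOf K) (D'.subgroupOf K') θK
      fun x hx => Subgroup.mem_subgroupOf.2 (hD (Subgroup.mem_subgroupOf.1 hx)))
  have hf₀ : ∀ x : K, f₀ (SectionModule.mk h x) = SectionModule.mk h' (θK x) := fun _ => rfl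
  refine ⟨⟨f₀.toZModLinearMap ℓ, fun b => ?_⟩, hf₀⟩
  obtain ⟨a, rfl⟩ := h.surj b
  ext x
  obtain ⟨y, rfl⟩ := SectionModule.exists_mk h x
  change f₀ (sectionRep h (p a) (SectionModule.mk h y)) =
    sectionRep h' (p a) (f₀ (SectionModule.mk h y))
  have hpa : p a = p' (θ a) := (DFunLike.congr_fun hθ a).symm
  rw [sectionRep_mk, hpa, hf₀, hf₀, sectionRep_mk]
  exact congrArg (SectionModule.mk h') (Subtype.ext (by
    change θ (a * y * a⁻¹) = θ a * θ y * (θ a)⁻¹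
    simp only [map_mul, map_inv]))

theorem exists_sectionRep_equiv (h : IsElemSection ℓ p K D) {V : Type*} [AddCommGroup V]
    [Module (ZMod ℓ) V] (ρ : Representation (ZMod ℓ) B V) {X : Type*} [Group X] (g : X →* K)
    (hg : Function.Surjective g) (F : X →* Multiplicative V) (hF : Function.Surjective F)
    (hD : ∀ x, F x = 1 ↔ (g x : A) ∈ D)
    (hconj : ∀ a x, ∃ x', (g x' : A) = a * g x * a⁻¹ ∧ (F x').toAdd = ρ (p a) (F x).toAdd) :
    ∃ e : Representation.Equiv (sectionRep h) ρ,
      ∀ x, e (SectionModule.mk h (g x)) = (F x).toAdd := by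
  let mkg : X →* Multiplicative (SectionModule h) :=
    MonoidHom.mk' (fun x => .ofAdd (SectionModule.mk h (g x))) fun x y => by
      rw [map_mul, SectionModule.mk_mul, ofAdd_add]
  have hmkg : Function.Surjective mkg := fun y => by
    obtain ⟨z, hz⟩ := SectionModule.exists_mk h y.toAdd
    obtain ⟨x, rfl⟩ := hg z
    exact ⟨x, hz⟩
  have hker : ∀ x, mkg x = 1 ↔ F x = 1 := fun x =>
    (SectionModule.mk_eq_zero_iff h (g x)).trans (hD x).symm
  let e₀ : SectionModule h →+ V :=
    AddMonoidHom.toMultiplicative.symm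
      (mkg.liftOfSurjective hmkg ⟨F, fun x hx => (hker x).1 hx⟩)
  have he₀ : ∀ x, e₀ (SectionModule.mk h (g x)) = (F x).toAdd := fun x =>
    congrArg Multiplicative.toAdd (mkg.liftOfRightInverse_comp_apply _ _ ⟨F, _⟩ x)
  have hbij : Function.Bijective (e₀.toZModLinearMap ℓ) := by
    refine ⟨(injective_iff_map_eq_zero _).2 fun y hy => ?_, fun w => ?_⟩
    · obtain ⟨x, rfl⟩ := hmkg (.ofAdd y)
      exact (hker x).2 ((he₀ x).symm.trans hy)
    · obtain ⟨x, rfl⟩ := hF (.ofAdd w)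
      exact ⟨_, he₀ x⟩
  refine ⟨Representation.Equiv.mk (LinearEquiv.ofBijective _ hbij) fun b => ?_, he₀⟩
  obtain ⟨a, rfl⟩ := h.surj b
  ext y
  obtain ⟨x, rfl⟩ := hmkg (.ofAdd y)
  obtain ⟨x', hx', hFx'⟩ := hconj a x
  change e₀ (sectionRep h (p a) (SectionModule.mk h (g x))) =
    ρ (p a) (e₀ (SectionModule.mk h (g x)))
  rw [sectionRep_mk, he₀, ← hFx', ← he₀]
  exact congrArg (fun z => e₀ (SectionModule.mk h z)) (Subtype.ext hx'.symm)

end Sections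

section Covers

variable {A : Type u} [Group A] [TopologicalSpace A] {B : Type v} [Group B] [TopologicalSpace B]

theorem isProLGroup_of_tendsto (ℓ : ℕ)
    (h : ∀ x : A, Tendsto (fun k : ℕ => x ^ ℓ ^ k) atTop (𝓝 1)) : IsProLGroup ℓ A := by
  intro U x
  induction x using QuotientGroup.induction_on with | H x => ?_
  have hU : (U.toSubgroup : Set A) ∈ 𝓝 (1 : A) := U.isOpen'.mem_nhds U.one_mem
  obtain ⟨k, hk⟩ := ((h x).eventually_mem hU).exists
  exact ⟨k, (QuotientGroup.eq_one_iff (N := U.toSubgroup) (x ^ ℓ ^ k)).2 hk⟩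

theorem IsProLGroup.exists_pow_mem {ℓ : ℕ} {K : Subgroup A} (hK : IsProLGroup ℓ K)
    (V : OpenNormalSubgroup A) {x : A} (hx : x ∈ K) : ∃ k : ℕ, x ^ ℓ ^ k ∈ V.toSubgroup := by
  let V' : OpenNormalSubgroup K :=
    { toSubgroup := V.toSubgroup.subgroupOf K
      isOpen' := V.isOpen'.preimage continuous_subtype_val }
  obtain ⟨k, hk⟩ := hK V' (QuotientGroup.mk ⟨x, hx⟩)
  exact ⟨k, (QuotientGroup.eq_one_iff (N := V'.toSubgroup) ((⟨x, hx⟩ : K) ^ ℓ ^ k)).1 hk⟩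

/-- The restriction of a continuous homomorphism to a subgroup. -/
def restrictHom (K : Subgroup A) (p : A →ₜ* B) : K →ₜ* B where
  toMonoidHom := p.toMonoidHom.comp K.subtype
  continuous_toFun := p.continuous_toFun.comp continuous_subtype_val

section Compact

variable [CompactSpace A] [T1Space B]

theorem map_iInf_eq_top_of_directed (p : A →ₜ* B) {ι : Type*} [Nonempty ι] {K : ι → Subgroup A}
    (hdir : Directed (· ≥ ·) K) (hcl : ∀ i, IsClosed (K i : Set A))
    (hK : ∀ i, (K i).map p.toMonoidHom = ⊤) : (⨅ i, K i).map p.toMonoidHom = ⊤ := by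
  refine eq_top_iff.2 fun b _ => ?_
  have hb : IsClosed (p ⁻¹' {b}) := isClosed_singleton.preimage p.continuous_toFun
  obtain ⟨x, hx⟩ := IsCompact.nonempty_iInter_of_directed_nonempty_isCompact_isClosed
    (fun i => (K i : Set A) ∩ p ⁻¹' {b})
    (fun i j => (hdir i j).imp fun k hk =>
      ⟨Set.inter_subset_inter_left _ hk.1, Set.inter_subset_inter_left _ hk.2⟩)
    (fun i => by
      obtain ⟨x, hx, hxb⟩ := (hK i).ge (Subgroup.mem_top b)
      exact ⟨x, hx, hxb⟩)
    (fun i => ((hcl i).inter hb).isCompact) (fun i => (hcl i).inter hb)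
  have hx' := Set.mem_iInter.1 hx
  exact ⟨x, Subgroup.mem_iInf.2 fun i => (hx' i).1, (hx' (Classical.arbitrary ι)).2⟩

theorem exists_le_minimal_closed_subgroup (p : A →ₜ* B) {P : Subgroup A}
    (hP : IsClosed (P : Set A)) (hmap : P.map p.toMonoidHom = ⊤) :
    ∃ K ≤ P, Minimal (fun K : Subgroup A => IsClosed (K : Set A) ∧ K.map p.toMonoidHom = ⊤) K := by
  let S : Set (Subgroup A)ᵒᵈ := {K | IsClosed (K.ofDual : Set A) ∧ K.ofDual.map p.toMonoidHom = ⊤}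
  have hbound : ∀ c ⊆ S, IsChain (· ≤ ·) c → ∀ K ∈ c, ∃ K' ∈ S, ∀ K ∈ c, K ≤ K' := by
    intro c hcS hc K₀ hK₀
    have : Nonempty c := ⟨⟨K₀, hK₀⟩⟩
    let k : c → Subgroup A := fun K => K.1.ofDual
    refine ⟨OrderDual.toDual (⨅ K, k K), ⟨?_, ?_⟩, fun K hK => iInf_le k ⟨K, hK⟩⟩
    · rw [OrderDual.ofDual_toDual, Subgroup.coe_iInf]
      exact isClosed_iInter fun K => (hcS K.2).1
    · exact map_iInf_eq_top_of_directed p hc.directed (fun K => (hcS K.2).1)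
        fun K => (hcS K.2).2
  obtain ⟨K, hKP, hK⟩ := zorn_le_nonempty₀ S hbound (OrderDual.toDual P) ⟨hP, hmap⟩
  exact ⟨K.ofDual, hKP, hK.1, fun K' hK' => hK.2 (y := OrderDual.toDual K') hK'⟩

theorem exists_le_isLFrattiniCover (ℓ : ℕ) (p : A →ₜ* B) {P : Subgroup A}
    (hP : IsClosed (P : Set A)) (hmap : P.map p.toMonoidHom = ⊤)
    (hker : ∀ x ∈ P, p x = 1 → Tendsto (fun k : ℕ => x ^ ℓ ^ k) atTop (𝓝 1)) :
    ∃ K ≤ P, IsClosed (K : Set A) ∧ IsLFrattiniCover ℓ (restrictHom K p) := by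
  obtain ⟨K, hKP, ⟨hK, hmap⟩, hmin⟩ := exists_le_minimal_closed_subgroup p hP hmap
  refine ⟨K, hKP, hK, fun b => ?_, fun K' hK' hmap' => ?_, ?_⟩
  · obtain ⟨x, hx, rfl⟩ := hmap.ge (Subgroup.mem_top b)
    exact ⟨⟨x, hx⟩, rfl⟩
  · have hKK' : K ≤ K'.map K.subtype :=
      hmin ⟨hK.isClosedEmbedding_subtypeVal.isClosedMap _ hK', by rwa [Subgroup.map_map]⟩
        (Subgroup.map_subtype_le _)
    exact eq_top_iff.2 fun x _ => by simpa using hKK' x.2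
  · exact isProLGroup_of_tendsto ℓ fun x =>
      tendsto_subtype_rng.2 (tendsto_subtype_rng.2 (hker x.1.1 (hKP x.1.2) x.2))

end Compact

theorem IsLFrattiniCover.surjective_of_comp {ℓ : ℕ} [T2Space A] {p : A →ₜ* B}
    (hp : IsLFrattiniCover ℓ p) {C : Type*} [Group C] [TopologicalSpace C] [CompactSpace C]
    (θ : C →ₜ* A) (hθ : Function.Surjective (p ∘ θ)) : Function.Surjective θ := by
  refine MonoidHom.range_eq_top.1 (hp.eq_top θ.toMonoidHom.range
    (isCompact_range θ.continuous_toFun).isClosed (eq_top_iff.2 fun b _ => ?_))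
  obtain ⟨x, rfl⟩ := hθ b
  exact ⟨θ x, ⟨x, rfl⟩, rfl⟩

theorem IsLFrattiniCover.isFrattiniCover_of_comp {ℓ : ℕ} {p : A →ₜ* B}
    (hp : IsLFrattiniCover ℓ p) {C : Type*} [Group C] [TopologicalSpace C] [DiscreteTopology C]
    (q : A →ₜ* C) (hq : Function.Surjective q) (r : C →* B) (hr : ∀ x, r (q x) = p x) :
    IsFrattiniCover r where
  surjective b := by
    obtain ⟨x, rfl⟩ := hp.surjective b
    exact ⟨q x, hr x⟩
  eq_top K hK := by
    have hcl : IsClosed (K.comap q.toMonoidHom : Set A) :=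
      (isClosed_discrete (K : Set C)).preimage q.continuous_toFun
    have htop : K.comap q.toMonoidHom = ⊤ := hp.eq_top _ hcl <| eq_top_iff.2 fun b _ => by
      obtain ⟨c, hc, rfl⟩ := hK.ge (Subgroup.mem_top b)
      obtain ⟨x, rfl⟩ := hq c
      exact ⟨x, hc, (hr x).symm⟩
    refine eq_top_iff.2 fun c _ => ?_
    obtain ⟨x, rfl⟩ := hq c
    exact htop.ge (Subgroup.mem_top x)

section Coprime

variable {ℓ : ℕ} [IsTopologicalGroup A] [CompactSpace A] {p : A →ₜ* B}

theorem IsLFrattiniCover.ker_le_of_coprime [Fact ℓ.Prime] (hp : IsLFrattiniCover ℓ p)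
    (hcop : (Nat.card B).Coprime ℓ) (V : OpenNormalSubgroup A)
    (hV : V.toSubgroup ≤ p.toMonoidHom.ker) : p.toMonoidHom.ker ≤ V.toSubgroup := by
  let q := QuotientGroup.mk' V.toSubgroup
  have hq : Function.Surjective q := QuotientGroup.mk'_surjective _
  have hqker : q.ker = V.toSubgroup := QuotientGroup.ker_mk' _
  let N := p.toMonoidHom.ker.map q
  have hN : N.Normal := p.toMonoidHom.normal_ker.map q hq
  have hNp : IsPGroup ℓ N := by
    rintro ⟨_, x, hx, rfl⟩
    obtain ⟨k, hk⟩ := hp.ker_isProL.exists_pow_mem V hx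
    exact ⟨k, Subtype.ext ((QuotientGroup.eq_one_iff (x ^ ℓ ^ k)).2 hk)⟩
  have hindex : N.index = Nat.card B := by
    rw [Subgroup.index_map_eq _ hq (hqker.le.trans hV), Subgroup.index_ker,
      MonoidHom.range_eq_top.2 hp.surjective, Subgroup.card_top]
  obtain ⟨n, hn⟩ := IsPGroup.iff_card.1 hNp
  obtain ⟨C, hC⟩ := Subgroup.exists_right_complement'_of_coprime (N := N)
    (by rw [hn, hindex]; exact hcop.symm.pow_left n)
  have hCtop : C.comap q = ⊤ := by
    refine hp.eq_top _ (Subgroup.isClosed_of_isOpen _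
      (Subgroup.isOpen_mono (hqker.ge.trans (Subgroup.ker_le_comap q C)) V.isOpen')) ?_
    refine eq_top_iff.2 fun b _ => ?_
    obtain ⟨a, rfl⟩ := hp.surjective b
    obtain ⟨⟨⟨_, x, hx, rfl⟩, c⟩, hxc⟩ := hC.2 (q a)
    refine ⟨x⁻¹ * a, ?_, ?_⟩
    · rw [SetLike.mem_coe, Subgroup.mem_comap, map_mul, map_inv, ← hxc, inv_mul_cancel_left]
      exact c.2
    · change p (x⁻¹ * a) = p a
      rw [map_mul, map_inv, show p x = 1 from hx, inv_one, one_mul]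
  rw [← hqker, ← Subgroup.map_eq_bot_iff]
  refine disjoint_top.1 ?_
  rw [← Subgroup.map_top_of_surjective q hq, ← hCtop, Subgroup.map_comap_eq_self_of_surjective hq]
  exact hC.disjoint

theorem IsLFrattiniCover.injective_of_coprime [Fact ℓ.Prime] [TotallyDisconnectedSpace A]
    [DiscreteTopology B] (hp : IsLFrattiniCover ℓ p) (hcop : (Nat.card B).Coprime ℓ) :
    Function.Injective p := by
  refine (injective_iff_map_eq_one p).2 fun x hx => by_contra fun hne => ?_
  have hker : IsOpen (p.toMonoidHom.ker : Set A) :=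
    (isOpen_discrete {(1 : B)}).preimage p.continuous_toFun
  obtain ⟨V, hV⟩ := ProfiniteGrp.exist_openNormalSubgroup_sub_open_nhds_of_one
    (isOpen_compl_singleton.inter hker) ⟨Ne.symm hne, one_mem _⟩
  exact (hV (hp.ker_le_of_coprime hcop V (fun y hy => (hV hy).2) hx)).1 rfl

end Coprime

end Covers

section Pullback

variable {ℓ : ℕ} {Λ : Type u} {Q : Type v} {G : Type w} [Group Λ] [TopologicalSpace Λ] [Group Q]
  [TopologicalSpace Q] [Group G] [TopologicalSpace G]

theorem exists_isLFrattiniCover_pullback [CompactSpace Λ] [T2Space Q] [CompactSpace G] [T1Space G]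
    (α : Λ →ₜ* Q) (hα : Function.Surjective α)
    (hker : ∀ x : Λ, α x = 1 → Tendsto (fun k : ℕ => x ^ ℓ ^ k) atTop (𝓝 1)) (π : G →ₜ* Q) :
    ∃ E : Subgroup (Λ × G), IsClosed (E : Set (Λ × G)) ∧ (∀ x ∈ E, α x.1 = π x.2) ∧
      IsLFrattiniCover ℓ (restrictHom E (ContinuousMonoidHom.snd Λ G)) := by
  let P : Subgroup (Λ × G) :=
    (α.toMonoidHom.comp (MonoidHom.fst Λ G)).eqLocus (π.toMonoidHom.comp (MonoidHom.snd Λ G))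
  have hP : IsClosed (P : Set (Λ × G)) :=
    isClosed_eq (α.continuous_toFun.comp continuous_fst) (π.continuous_toFun.comp continuous_snd)
  have hmap : P.map (MonoidHom.snd Λ G) = ⊤ := eq_top_iff.2 fun g _ => by
    obtain ⟨x, hx⟩ := hα (π g)
    exact ⟨(x, g), hx, rfl⟩
  have hpow : ∀ x ∈ P, x.2 = 1 → Tendsto (fun k : ℕ => x ^ ℓ ^ k) atTop (𝓝 1) := by
    rintro ⟨x, g⟩ (hx : α x = π g) (rfl : g = 1)
    refine (Prod.tendsto_iff _ _).2 ⟨hker x (hx.trans (map_one π)), ?_⟩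
    exact tendsto_const_nhds.congr fun k => (one_pow _).symm
  obtain ⟨E, hEP, hE, hcov⟩ :=
    exists_le_isLFrattiniCover ℓ (ContinuousMonoidHom.snd Λ G) hP hmap hpow
  exact ⟨E, hE, fun x hx => hEP hx, hcov⟩

theorem exists_lift_of_coprime [Fact ℓ.Prime] [IsTopologicalGroup Λ] [CompactSpace Λ]
    [TotallyDisconnectedSpace Λ] [T2Space Q] [Finite G] [DiscreteTopology G]
    (hcop : (Nat.card G).Coprime ℓ) (α : Λ →ₜ* Q) (hα : Function.Surjective α)
    (hker : ∀ x : Λ, α x = 1 → Tendsto (fun k : ℕ => x ^ ℓ ^ k) atTop (𝓝 1)) (ρ : G →* Q) :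
    ∃ ρ' : G →* Λ, ∀ g, α (ρ' g) = ρ g := by
  obtain ⟨E, hE, hαρ, hcov⟩ :=
    exists_isLFrattiniCover_pullback α hα hker ⟨ρ, continuous_of_discreteTopology⟩
  have : CompactSpace E := isCompact_iff_compactSpace.1 hE.isCompact
  let e : E ≃* G := MulEquiv.ofBijective (restrictHom E (ContinuousMonoidHom.snd Λ G))
    ⟨hcov.injective_of_coprime hcop, hcov.surjective⟩
  refine ⟨((MonoidHom.fst Λ G).comp E.subtype).comp e.symm.toMonoidHom, fun g => ?_⟩
  exact (hαρ _ (e.symm g).2).trans (congrArg ρ (e.apply_symm_apply g))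

end Pullback

section UniversalCover

variable {G : Type u} [Group G] [TopologicalSpace G]

open CategoryTheory ProfiniteGrp ProfiniteCompletion in
theorem exists_profiniteCompletion_lift {W : Type u} [Group W] {F : ProfiniteGrp.{u}} (φ : W →* F) :
    ∃ θ : completion (GrpCat.of W) →ₜ* F, ∀ w, θ (etaFn (GrpCat.of W) w) = φ w :=
  ⟨(lift (GrpCat.ofHom φ)).hom, fun w => ConcreteCategory.congr_hom (lift_eta (GrpCat.ofHom φ)) w⟩

theorem exists_projective_profiniteGrp (G : Type u) [Group G] [TopologicalSpace G]
    [DiscreteTopology G] [Finite G] :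
    ∃ (P : ProfiniteGrp.{u}) (p : P →ₜ* G), Function.Surjective p ∧
      ∀ (F : ProfiniteGrp.{u}) (χ : F →ₜ* G), Function.Surjective χ →
        ∃ θ : P →ₜ* F, χ.comp θ = p := by
  obtain ⟨p, hp⟩ := exists_profiniteCompletion_lift (F := ProfiniteGrp.of G)
    (FreeGroup.lift (id : G → G))
  refine ⟨_, p, fun g => ⟨_, (hp (FreeGroup.of g)).trans (by simp)⟩, fun F χ hχ => ?_⟩
  obtain ⟨θ, hθ⟩ := exists_profiniteCompletion_lift (FreeGroup.lift (Function.surjInv hχ))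
  refine ⟨θ, DFunLike.coe_injective ((ProfiniteGrp.ProfiniteCompletion.denseRange _).equalizer
    (χ.comp θ).continuous_toFun p.continuous_toFun (funext fun w => ?_))⟩
  have hlift : χ.toMonoidHom.comp (FreeGroup.lift (Function.surjInv hχ)) = FreeGroup.lift id :=
    FreeGroup.ext_hom _ _ fun g => by simp [Function.surjInv_eq]
  exact (congrArg χ (hθ w)).trans ((DFunLike.congr_fun hlift w).trans (hp w).symm)

variable (ℓ : ℕ) {P : ProfiniteGrp.{u}} (p : P →ₜ* G)

/-- The open normal subgroups `V` of `P` for which the image of `ker p` in `P / V` is an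
`ℓ`-group. -/
def ProLIndex : Type u :=
  {V : OpenNormalSubgroup P // ∀ x, p x = 1 → ∃ k : ℕ, x ^ ℓ ^ k ∈ V.toSubgroup}

variable {ℓ p}

instance (V : OpenNormalSubgroup P) : DiscreteTopology (P ⧸ V.toSubgroup) :=
  QuotientGroup.discreteTopology V.isOpen'

/-- The product of `G` and the finite quotients `P / V` of `P` in which `ker p` becomes an
`ℓ`-group. The image of `P` in it is the largest quotient of `P` over `G` with pro-`ℓ` kernel. -/
abbrev ProLProduct (ℓ : ℕ) (p : P →ₜ* G) : Type u :=
  G × ∀ V : ProLIndex ℓ p, P ⧸ V.1.toSubgroup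

/-- The map of `P` to the product of its quotients collected in `ProLProduct`. -/
def proLDiagonal (ℓ : ℕ) (p : P →ₜ* G) : P →ₜ* ProLProduct ℓ p where
  toMonoidHom := p.toMonoidHom.prod (MonoidHom.pi fun V => QuotientGroup.mk' V.1.toSubgroup)
  continuous_toFun := p.continuous_toFun.prodMk (continuous_pi fun _ => continuous_quot_mk)

theorem tendsto_proLDiagonal_pow {x : P} (hx : p x = 1) :
    Tendsto (fun k : ℕ => proLDiagonal ℓ p x ^ ℓ ^ k) atTop (𝓝 1) := by
  refine (Prod.tendsto_iff _ _).2 ⟨?_, tendsto_pi_nhds.2 fun V => ?_⟩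
  · exact tendsto_const_nhds.congr fun k => (show p x ^ ℓ ^ k = 1 by rw [hx, one_pow]).symm
  · obtain ⟨k, hk⟩ := V.2 x hx
    refine tendsto_const_nhds.congr' ((eventually_ge_atTop k).mono fun n hn => Eq.symm ?_)
    refine (QuotientGroup.eq_one_iff (N := V.1.toSubgroup) (x ^ ℓ ^ n)).2 ?_
    obtain ⟨m, rfl⟩ := Nat.exists_eq_add_of_le hn
    rw [pow_add, pow_mul]
    exact pow_mem hk _

theorem eq_one_of_proLDiagonal_eq_one {F : ProfiniteGrp.{u}} {χ : F →ₜ* G}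
    (hχ : IsProLGroup ℓ χ.toMonoidHom.ker) {θ : P →ₜ* F} (hθ : χ.comp θ = p) {x : P}
    (hx : proLDiagonal ℓ p x = 1) : θ x = 1 := by
  by_contra hne
  obtain ⟨V, hV⟩ := ProfiniteGrp.exist_openNormalSubgroup_sub_open_nhds_of_one
    (isOpen_compl_singleton (x := θ x)) (Ne.symm hne)
  let V' : ProLIndex ℓ p :=
    ⟨{ toSubgroup := V.toSubgroup.comap θ.toMonoidHom
       isOpen' := V.isOpen'.preimage θ.continuous_toFun }, fun y hy => by
      obtain ⟨k, hk⟩ := hχ.exists_pow_mem V (x := θ y) ((DFunLike.congr_fun hθ y).trans hy)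
      exact ⟨k, by simpa using hk⟩⟩
  have hxV : x ∈ V'.1.toSubgroup :=
    (QuotientGroup.eq_one_iff x).1 (congrFun (congrArg Prod.snd hx) V')
  exact hV hxV rfl

theorem exists_lift_range_proLDiagonal [T2Space G] {F : ProfiniteGrp.{u}} {χ : F →ₜ* G}
    (hχ : IsProLGroup ℓ χ.toMonoidHom.ker) {θ : P →ₜ* F} (hθ : χ.comp θ = p) :
    ∃ θ' : (proLDiagonal ℓ p).toMonoidHom.range →ₜ* F, ∀ y, χ (θ' y) = y.1.1 := by
  let q := (proLDiagonal ℓ p).toMonoidHom.rangeRestrict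
  have hq : Function.Surjective q := MonoidHom.rangeRestrict_surjective _
  have hqc : Continuous q := (proLDiagonal ℓ p).continuous_toFun.subtype_mk _
  let θ' := q.liftOfSurjective hq ⟨θ.toMonoidHom, fun x hx =>
    eq_one_of_proLDiagonal_eq_one hχ hθ (congrArg Subtype.val hx)⟩
  have hθ' : ∀ x, θ' (q x) = θ x := q.liftOfRightInverse_comp_apply _ _ _
  have hcont : Continuous θ' :=
    (hqc.isClosedMap.isQuotientMap hqc hq).continuous_iff.2
      (θ.continuous_toFun.congr fun x => (hθ' x).symm)
  refine ⟨⟨θ', hcont⟩, fun y => ?_⟩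
  obtain ⟨x, rfl⟩ := hq y
  exact (congrArg χ (hθ' x)).trans (DFunLike.congr_fun hθ x)

theorem exists_isUniversalLFrattiniCover (ℓ : ℕ) (G : Type u) [Group G] [TopologicalSpace G]
    [DiscreteTopology G] [Finite G] :
    ∃ (E : ProfiniteGrp.{u}) (ψ : E →ₜ* G), IsUniversalLFrattiniCover ℓ ψ := by
  obtain ⟨P, p, hp, hproj⟩ := exists_projective_profiniteGrp G
  have hclosed : IsClosed ((proLDiagonal ℓ p).toMonoidHom.range : Set (ProLProduct ℓ p)) :=
    (isCompact_range (proLDiagonal ℓ p).continuous_toFun).isClosed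
  obtain ⟨K, hKR, hK, hcov⟩ := exists_le_isLFrattiniCover ℓ
    (ContinuousMonoidHom.fst G (∀ V : ProLIndex ℓ p, P ⧸ V.1.toSubgroup)) hclosed
    (eq_top_iff.2 fun g _ => by
      obtain ⟨x, rfl⟩ := hp g
      exact ⟨_, ⟨x, rfl⟩, rfl⟩)
    (by
      rintro _ ⟨x, rfl⟩ hx
      exact tendsto_proLDiagonal_pow hx)
  have : CompactSpace K := isCompact_iff_compactSpace.1 hK.isCompact
  refine ⟨ProfiniteGrp.of K, restrictHom K _, hcov, fun F χ hχ => ?_⟩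
  obtain ⟨θ, hθ⟩ := hproj F χ hχ.surjective
  obtain ⟨θ', hθ'⟩ := exists_lift_range_proLDiagonal hχ.ker_isProL hθ
  exact ⟨θ'.comp ⟨Subgroup.inclusion hKR, continuous_inclusion hKR⟩,
    ContinuousMonoidHom.ext fun x => hθ' _⟩

end UniversalCover

section PadicIntegers

variable {ℓ : ℕ} [Fact ℓ.Prime]

theorem isLocallyConstant_of_map_pow_eq_zero {R : Type*} [Ring R] (f : ℤ_[ℓ] →+* R) {k : ℕ}
    (hf : f ((ℓ : ℤ_[ℓ]) ^ k) = 0) : IsLocallyConstant f := by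
  refine (IsLocallyConstant.iff_eventually_eq f).2 fun x => ?_
  filter_upwards [Metric.ball_mem_nhds x (ε := (ℓ : ℝ) ^ (-(k : ℤ) + 1))
    (zpow_pos (mod_cast (Fact.out : ℓ.Prime).pos) _)] with y hy
  rw [Metric.mem_ball, dist_eq_norm, ← PadicInt.norm_le_pow_iff_norm_lt_pow_add_one,
    PadicInt.norm_le_pow_iff_mem_span_pow, Ideal.mem_span_singleton] at hy
  obtain ⟨c, hc⟩ := hy
  rw [← sub_eq_zero, ← map_sub, hc, map_mul, hf, zero_mul]

theorem isLocallyConstant_toZModPow (n : ℕ) :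
    IsLocallyConstant (PadicInt.toZModPow n : ℤ_[ℓ] →+* ZMod (ℓ ^ n)) :=
  isLocallyConstant_of_map_pow_eq_zero _ (k := n)
    (by rw [← Nat.cast_pow, map_natCast, ZMod.natCast_self])

theorem isLocallyConstant_toZMod :
    IsLocallyConstant (PadicInt.toZMod : ℤ_[ℓ] →+* ZMod ℓ) :=
  isLocallyConstant_of_map_pow_eq_zero _ (k := 1)
    (by rw [pow_one, map_natCast, ZMod.natCast_self])

theorem castHom_comp_toZModPow :
    (ZMod.castHom (dvd_pow_self ℓ two_ne_zero) (ZMod ℓ)).comp (PadicInt.toZModPow 2) =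
      (PadicInt.toZMod : ℤ_[ℓ] →+* ZMod ℓ) :=
  DFunLike.coe_injective (PadicInt.denseRange_natCast.equalizer
    ((isLocallyConstant_toZModPow 2).comp _).continuous
    isLocallyConstant_toZMod.continuous (funext fun n => by simp))

theorem toZMod_eq_zero_iff_dvd {x : ℤ_[ℓ]} : PadicInt.toZMod x = 0 ↔ (ℓ : ℤ_[ℓ]) ∣ x := by
  rw [← RingHom.mem_ker, PadicInt.ker_toZMod, PadicInt.maximalIdeal_eq_span_p,
    Ideal.mem_span_singleton]

theorem tendsto_zero_of_pow_dvd {x : ℕ → ℤ_[ℓ]} (hx : ∀ k, (ℓ : ℤ_[ℓ]) ^ k ∣ x k) :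
    Tendsto x atTop (𝓝 0) := by
  refine squeeze_zero_norm (a := fun k => ((ℓ : ℝ)⁻¹) ^ k) (fun k => ?_)
    (tendsto_pow_atTop_nhds_zero_of_lt_one (by positivity)
      (inv_lt_one_of_one_lt₀ (mod_cast (Fact.out : ℓ.Prime).one_lt)))
  rw [inv_pow, ← zpow_natCast, ← zpow_neg, PadicInt.norm_le_pow_iff_mem_span_pow,
    Ideal.mem_span_singleton]
  exact hx k

end PadicIntegers

section LiftingMatrices

variable {ι : Type*} [Fintype ι] [DecidableEq ι]

theorem natCast_pow_dvd_pow_pow_sub_one {R : Type*} [Ring R] {ℓ : ℕ} {x : R}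
    (hx : (ℓ : R) ∣ x - 1) (k : ℕ) : (ℓ : R) ^ k ∣ x ^ ℓ ^ k - 1 := by
  obtain ⟨b, hb⟩ := hx
  have hdvd : (ℓ : Polynomial ℤ) ^ (k + 1) ∣
      (1 + (ℓ : Polynomial ℤ) * .X) ^ ℓ ^ k - 1 ^ ℓ ^ k :=
    dvd_sub_pow_of_dvd_sub (by simp) k
  have := map_dvd (Polynomial.aeval b) ((pow_dvd_pow _ k.le_succ).trans hdvd)
  simpa [← hb] using this

theorem natCast_mul_matrix_apply {R : Type*} [Semiring R] (n : ℕ) (b : Matrix ι ι R) (i j : ι) :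
    ((n : Matrix ι ι R) * b) i j = n * b i j := by
  rw [← Matrix.diagonal_natCast, Matrix.diagonal_mul]

theorem natCast_dvd_matrix_iff {R : Type*} [Semiring R] {n : ℕ} {x : Matrix ι ι R} :
    (n : Matrix ι ι R) ∣ x ↔ ∀ i j, (n : R) ∣ x i j := by
  refine ⟨?_, fun h => ?_⟩
  · rintro ⟨b, rfl⟩ i j
    exact ⟨b i j, natCast_mul_matrix_apply n b i j⟩
  · choose b hb using h
    exact ⟨b, Matrix.ext fun i j => (hb i j).trans (natCast_mul_matrix_apply n b i j).symm⟩

theorem isUnit_of_isUnit_mapMatrix {R S : Type*} [CommRing R] [CommRing S] (f : R →+* S)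
    [IsLocalHom f] {x : Matrix ι ι R} (hx : IsUnit (f.mapMatrix x)) : IsUnit x := by
  rw [Matrix.isUnit_iff_isUnit_det, ← RingHom.map_det] at hx
  exact (Matrix.isUnit_iff_isUnit_det x).2 (hx.of_map f)

theorem surjective_units_map_mapMatrix {R S : Type*} [CommRing R] [CommRing S] (f : R →+* S)
    [IsLocalHom f] (hf : Function.Surjective f) :
    Function.Surjective (Units.map (f.mapMatrix (m := ι)).toMonoidHom) := fun u => by
  obtain ⟨x, hx⟩ : ∃ x, f.mapMatrix x = u.1 :=
    ⟨u.1.map (Function.surjInv hf), Matrix.ext fun i j => Function.surjInv_eq hf (u.1 i j)⟩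
  exact ⟨(isUnit_of_isUnit_mapMatrix f (hx ▸ u.isUnit)).unit, Units.ext hx⟩

theorem tendsto_units_pow {R : Type*} [Monoid R] [TopologicalSpace R] {ℓ : ℕ} {x : Rˣ}
    (hx : Tendsto (fun k : ℕ => (x : R) ^ ℓ ^ k) atTop (𝓝 1))
    (hinv : Tendsto (fun k : ℕ => (↑x⁻¹ : R) ^ ℓ ^ k) atTop (𝓝 1)) :
    Tendsto (fun k : ℕ => x ^ ℓ ^ k) atTop (𝓝 1) := by
  refine Units.isInducing_embedProduct.tendsto_nhds_iff.2 ((Prod.tendsto_iff _ _).2 ⟨?_, ?_⟩)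
  · simpa using hx
  · simpa [Function.comp_def, ← inv_pow] using (MulOpposite.continuous_op.tendsto _).comp hinv

variable {ℓ : ℕ} [Fact ℓ.Prime]

theorem tendsto_matrix_pow_of_map_toZMod_eq_one {x : Matrix ι ι ℤ_[ℓ]}
    (hx : (PadicInt.toZMod : ℤ_[ℓ] →+* ZMod ℓ).mapMatrix x = 1) :
    Tendsto (fun k : ℕ => x ^ ℓ ^ k) atTop (𝓝 1) := by
  have hred : (PadicInt.toZMod : ℤ_[ℓ] →+* ZMod ℓ).mapMatrix (x - 1) = 0 := by
    rw [map_sub, hx, map_one, sub_self]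
  have hdvd : (ℓ : Matrix ι ι ℤ_[ℓ]) ∣ x - 1 := natCast_dvd_matrix_iff.2 fun i j =>
    toZMod_eq_zero_iff_dvd.1 (congrFun (congrFun hred i) j)
  refine tendsto_sub_nhds_zero_iff.1 (tendsto_pi_nhds.2 fun i => tendsto_pi_nhds.2 fun j =>
    tendsto_zero_of_pow_dvd fun k => ?_)
  have hpow := natCast_pow_dvd_pow_pow_sub_one hdvd k
  rw [← Nat.cast_pow] at hpow ⊢
  exact natCast_dvd_matrix_iff.1 hpow i j

theorem exists_padic_lift {H : Type*} [Group H] [Finite H]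
    (hcop : (Nat.card H).Coprime ℓ) (M : H →* Matrix ι ι (ZMod ℓ)) :
    ∃ A : H →* Matrix ι ι ℤ_[ℓ],
      (PadicInt.toZMod : ℤ_[ℓ] →+* ZMod ℓ).mapMatrix.toMonoidHom.comp A = M := by
  let _ : TopologicalSpace H := ⊥
  have : DiscreteTopology H := ⟨rfl⟩
  have : CompactSpace (Matrix ι ι ℤ_[ℓ]) := inferInstanceAs (CompactSpace (ι → ι → ℤ_[ℓ]))
  have : TotallyDisconnectedSpace (Matrix ι ι ℤ_[ℓ])ˣ :=
    ⟨isTotallyDisconnected_of_image (Units.continuous_val (M := Matrix ι ι ℤ_[ℓ])).continuousOn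
      Units.val_injective
      (isTotallyDisconnected_of_totallyDisconnectedSpace (α := ι → ι → ℤ_[ℓ]) _)⟩
  have hsurj := ZMod.ringHom_surjective (PadicInt.toZMod : ℤ_[ℓ] →+* ZMod ℓ)
  have := IsLocalHom.of_surjective _ hsurj
  let red : Matrix ι ι ℤ_[ℓ] →* Matrix ι ι (ZMod ℓ) :=
    (PadicInt.toZMod : ℤ_[ℓ] →+* ZMod ℓ).mapMatrix.toMonoidHom
  have hred : Continuous red := continuous_id.matrix_map isLocallyConstant_toZMod.continuous
  have hker (x : (Matrix ι ι ℤ_[ℓ])ˣ) (hx : Units.map red x = 1) :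
      Tendsto (fun k : ℕ => x ^ ℓ ^ k) atTop (𝓝 1) :=
    tendsto_units_pow
      (tendsto_matrix_pow_of_map_toZMod_eq_one (congrArg Units.val hx))
      (tendsto_matrix_pow_of_map_toZMod_eq_one
        (congrArg Units.val ((map_inv _ x).trans (inv_eq_one.2 hx))))
  obtain ⟨A, hA⟩ := exists_lift_of_coprime hcop ⟨Units.map red, hred.units_map red⟩
    (surjective_units_map_mapMatrix _ hsurj) hker M.toHomUnits
  exact ⟨(Units.coeHom _).comp A, MonoidHom.ext fun h => congrArg Units.val (hA h)⟩

end LiftingMatrices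

section SemidirectTopology

variable {N : Type v} {G : Type w} [Group N] [Group G] [TopologicalSpace N] [TopologicalSpace G]
  {φ : G →* MulAut N}

/-- The product topology on a semidirect product. -/
instance : TopologicalSpace (N ⋊[φ] G) :=
  TopologicalSpace.induced SemidirectProduct.equivProd inferInstance

/-- A semidirect product is homeomorphic to the product of its factors. -/
def semidirectHomeomorph : (N ⋊[φ] G) ≃ₜ N × G :=
  SemidirectProduct.equivProd.toHomeomorphOfIsInducing ⟨rfl⟩

instance [CompactSpace N] [CompactSpace G] : CompactSpace (N ⋊[φ] G) :=
  semidirectHomeomorph.symm.compactSpace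

instance [T2Space N] [T2Space G] : T2Space (N ⋊[φ] G) :=
  semidirectHomeomorph.symm.t2Space

instance [TotallyDisconnectedSpace N] [TotallyDisconnectedSpace G] :
    TotallyDisconnectedSpace (N ⋊[φ] G) :=
  semidirectHomeomorph.symm.totallyDisconnectedSpace

instance [DiscreteTopology N] [DiscreteTopology G] : DiscreteTopology (N ⋊[φ] G) :=
  semidirectHomeomorph.symm.discreteTopology

theorem continuous_left : Continuous fun x : N ⋊[φ] G => x.left :=
  continuous_fst.comp semidirectHomeomorph.continuous

theorem continuous_right : Continuous fun x : N ⋊[φ] G => x.right :=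
  continuous_snd.comp semidirectHomeomorph.continuous

theorem continuous_mk {X : Type*} [TopologicalSpace X] {f : X → N} {g : X → G} (hf : Continuous f)
    (hg : Continuous g) : Continuous fun x => (⟨f x, g x⟩ : N ⋊[φ] G) :=
  semidirectHomeomorph.symm.continuous.comp (hf.prodMk hg)

theorem continuous_inl : Continuous (SemidirectProduct.inl : N →* N ⋊[φ] G) :=
  continuous_mk continuous_id continuous_const

theorem isTopologicalGroup_semidirect [IsTopologicalGroup N] [DiscreteTopology G]
    (hφ : ∀ g, Continuous (φ g)) : IsTopologicalGroup (N ⋊[φ] G) := by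
  have hact : Continuous fun x : G × N => φ x.1 x.2 := continuous_prod_of_discrete_left.2 hφ
  exact
    { continuous_mul := continuous_mk
        ((continuous_left.comp continuous_fst).mul (hact.comp
          ((continuous_right.comp continuous_fst).prodMk (continuous_left.comp continuous_snd))))
        ((continuous_right.comp continuous_fst).mul (continuous_right.comp continuous_snd))
      continuous_inv := continuous_mk
        (hact.comp (continuous_right.inv.prodMk continuous_left.inv)) continuous_right.inv }

end SemidirectTopology

section MatrixActions

variable {t : ℕ} {H : Type u} [Group H]

/-- A representation of `H` on `V`, seen as an action of `H` by automorphisms of the group `V`,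
written multiplicatively. -/
def repAut {R : Type*} {V : Type*} [CommRing R] [AddCommGroup V] [Module R V]
    (ρ : Representation R H V) : H →* MulAut (Multiplicative V) where
  toFun h :=
    { AddMonoidHom.toMultiplicative (ρ h).toAddMonoidHom with
      invFun := fun v => .ofAdd (ρ h⁻¹ v.toAdd)
      left_inv := fun v => ρ.inv_self_apply h v.toAdd
      right_inv := fun v => ρ.self_inv_apply h v.toAdd }
  map_one' := MulEquiv.ext fun v => congrArg (fun f => Multiplicative.ofAdd (f v.toAdd)) (map_one ρ)
  map_mul' g h := MulEquiv.ext fun v =>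
    congrArg (fun f => Multiplicative.ofAdd (f v.toAdd)) (map_mul ρ g h)

variable {R : Type*} {S : Type*} [CommRing R] [CommRing S]

/-- The linear representation of `H` on `R ^ t` given by a matrix representation. -/
noncomputable def matRep (A : H →* Matrix (Fin t) (Fin t) R) : Representation R H (Fin t → R) :=
  (Matrix.toLinAlgEquiv' : Matrix (Fin t) (Fin t) R ≃ₐ[R] _).toMonoidHom.comp A

theorem matRep_apply (A : H →* Matrix (Fin t) (Fin t) R) (h : H) (v : Fin t → R) :
    matRep A h v = (A h).mulVec v :=
  Matrix.toLinAlgEquiv'_apply _ _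

/-- The action of `H` on `R ^ t`, written multiplicatively, given by a matrix representation. -/
noncomputable abbrev matAut (A : H →* Matrix (Fin t) (Fin t) R) :
    H →* MulAut (Multiplicative (Fin t → R)) :=
  repAut (matRep A)

/-- The map `R ^ t → S ^ t` that applies `f : R → S` to all coordinates. -/
def coordHom (f : R →+* S) (t : ℕ) :
    Multiplicative (Fin t → R) →* Multiplicative (Fin t → S) :=
  AddMonoidHom.toMultiplicative (f.toAddMonoidHom.compLeft (Fin t))

theorem coordHom_surjective {f : R →+* S} (hf : Function.Surjective f) :
    Function.Surjective (coordHom f t) :=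
  hf.comp_left

theorem continuous_coordHom [TopologicalSpace R] [TopologicalSpace S] {f : R →+* S}
    (hf : Continuous f) : Continuous (coordHom f t) :=
  continuous_pi fun i => hf.comp (continuous_apply i)

/-- The extension of scalars of a matrix representation along `f : R → S`. -/
abbrev mapRep (f : R →+* S) (A : H →* Matrix (Fin t) (Fin t) R) : H →* Matrix (Fin t) (Fin t) S :=
  f.mapMatrix.toMonoidHom.comp A

theorem coordHom_matAut (f : R →+* S) (A : H →* Matrix (Fin t) (Fin t) R) (h : H)
    (v : Multiplicative (Fin t → R)) :
    coordHom f t (matAut A h v) = matAut (mapRep f A) h (coordHom f t v) := by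
  change Multiplicative.ofAdd (f ∘ matRep A h v.toAdd) =
    Multiplicative.ofAdd (matRep (mapRep f A) h (f ∘ v.toAdd))
  rw [matRep_apply, matRep_apply]
  exact congrArg _ (funext fun i => f.map_mulVec _ _ i)

/-- The map `R ^ t ⋊ H → S ^ t ⋊ H` that applies `f : R → S` to all coordinates and is the identity
on `H`. -/
noncomputable def semidirectMap (f : R →+* S) (A : H →* Matrix (Fin t) (Fin t) R) :
    Multiplicative (Fin t → R) ⋊[matAut A] H →*
      Multiplicative (Fin t → S) ⋊[matAut (mapRep f A)] H :=
  SemidirectProduct.map (coordHom f t) (MonoidHom.id H)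
    fun h => MonoidHom.ext (coordHom_matAut f A h)

theorem semidirectMap_surjective {f : R →+* S} (hf : Function.Surjective f)
    (A : H →* Matrix (Fin t) (Fin t) R) : Function.Surjective (semidirectMap f A) := fun x => by
  obtain ⟨v, hv⟩ := coordHom_surjective hf x.left
  exact ⟨⟨v, x.right⟩, SemidirectProduct.ext hv rfl⟩

theorem continuous_semidirectMap [TopologicalSpace R] [TopologicalSpace S] [TopologicalSpace H]
    {f : R →+* S} (hf : Continuous f) (A : H →* Matrix (Fin t) (Fin t) R) :
    Continuous (semidirectMap f A) :=
  continuous_mk ((continuous_coordHom hf).comp continuous_left) continuous_right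

theorem semidirectMap_inl (f : R →+* S) (A : H →* Matrix (Fin t) (Fin t) R)
    (v : Multiplicative (Fin t → R)) :
    semidirectMap f A (SemidirectProduct.inl v) = SemidirectProduct.inl (coordHom f t v) :=
  SemidirectProduct.map_inl _ _ _ v

theorem exists_inl_of_semidirectMap_eq_inl {f : R →+* S} {A : H →* Matrix (Fin t) (Fin t) R}
    {x : Multiplicative (Fin t → R) ⋊[matAut A] H} {w : Multiplicative (Fin t → S)}
    (hx : semidirectMap f A x = SemidirectProduct.inl w) :
    ∃ v, coordHom f t v = w ∧ SemidirectProduct.inl v = x :=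
  ⟨x.left, congrArg SemidirectProduct.left hx,
    SemidirectProduct.ext rfl (congrArg SemidirectProduct.right hx).symm⟩

theorem inl_matAut_eq_conj (A : H →* Matrix (Fin t) (Fin t) R)
    (x : Multiplicative (Fin t → R) ⋊[matAut A] H) (v : Multiplicative (Fin t → R)) :
    SemidirectProduct.inl (matAut A x.right v) = x * SemidirectProduct.inl v * x⁻¹ := by
  ext <;> simp [mul_comm]

end MatrixActions

section PadicSemidirect

variable {ℓ : ℕ} [Fact ℓ.Prime] {t : ℕ} {H : Type u} [Group H]

/-- The group `ℤ_ℓ ^ t ⋊ H`, for an action of `H` on `ℤ_ℓ ^ t` given by matrices. -/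
abbrev PadicSemidirect (A : H →* Matrix (Fin t) (Fin t) ℤ_[ℓ]) : Type u :=
  Multiplicative (Fin t → ℤ_[ℓ]) ⋊[matAut A] H

variable [TopologicalSpace H]

instance [DiscreteTopology H] (A : H →* Matrix (Fin t) (Fin t) ℤ_[ℓ]) :
    IsTopologicalGroup (PadicSemidirect A) :=
  isTopologicalGroup_semidirect fun h =>
    (LinearMap.continuous_on_pi (matRep A h) : Continuous (matRep A h))

/-- The reduction map `ℤ_ℓ ^ t ⋊ H → (ℤ/ℓ) ^ t ⋊ H`. -/
noncomputable def padicRed (A : H →* Matrix (Fin t) (Fin t) ℤ_[ℓ]) :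
    PadicSemidirect A →ₜ* ZPow ℓ t ⋊[matAut (mapRep PadicInt.toZMod A)] H :=
  ⟨semidirectMap PadicInt.toZMod A, continuous_semidirectMap isLocallyConstant_toZMod.continuous A⟩

end PadicSemidirect

section PadicFrattini

variable {ℓ : ℕ} [Fact ℓ.Prime]

/-- A closed subgroup of a topological `ℤ_ℓ`-module, as a submodule. -/
def closedSubmodule {V : Type*} [AddCommGroup V] [TopologicalSpace V] [Module ℤ_[ℓ] V]
    [ContinuousSMul ℤ_[ℓ] V] (L : AddSubgroup V) (hL : IsClosed (L : Set V)) :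
    Submodule ℤ_[ℓ] V :=
  { L with
    smul_mem' := fun c x hx =>
      PadicInt.denseRange_natCast.induction_on (p := fun c : ℤ_[ℓ] => c • x ∈ L) c
        (hL.preimage (continuous_id.smul continuous_const))
        fun n => by simpa only [Nat.cast_smul_eq_nsmul] using L.nsmul_mem hx n }

theorem eq_top_of_surjective_mod {V : Type*} [AddCommGroup V] [Module ℤ_[ℓ] V]
    [Module.Finite ℤ_[ℓ] V] (L : Submodule ℤ_[ℓ] V)
    (hL : ∀ v, ∃ w ∈ L, ∃ u, v = w + (ℓ : ℤ_[ℓ]) • u) : L = ⊤ := by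
  refine top_unique (Submodule.le_of_le_smul_of_le_jacobson_bot
    (I := IsLocalRing.maximalIdeal ℤ_[ℓ])
    Module.Finite.fg_top (IsLocalRing.jacobson_eq_maximalIdeal ⊥ bot_ne_top).ge fun v _ => ?_)
  obtain ⟨w, hw, u, rfl⟩ := hL v
  refine Submodule.add_mem_sup hw (Submodule.smul_mem_smul ?_ Submodule.mem_top)
  rw [PadicInt.maximalIdeal_eq_span_p]
  exact Ideal.mem_span_singleton_self _

theorem exists_eq_smul_of_coordHom_toZMod_eq_one {t : ℕ} {v : Multiplicative (Fin t → ℤ_[ℓ])}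
    (hv : coordHom (PadicInt.toZMod : ℤ_[ℓ] →+* ZMod ℓ) t v = 1) :
    ∃ u : Fin t → ℤ_[ℓ], v.toAdd = (ℓ : ℤ_[ℓ]) • u := by
  choose u hu using fun i => toZMod_eq_zero_iff_dvd.1 (congrFun hv i)
  exact ⟨u, funext hu⟩

variable {t : ℕ} {H : Type u} [Group H] [TopologicalSpace H]

theorem tendsto_pow_of_padicRed_eq_one (A : H →* Matrix (Fin t) (Fin t) ℤ_[ℓ])
    {x : PadicSemidirect A} (hx : padicRed A x = 1) :
    Tendsto (fun k : ℕ => x ^ ℓ ^ k) atTop (𝓝 1) := by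
  obtain ⟨v, -, rfl⟩ := exists_inl_of_semidirectMap_eq_inl (hx.trans (map_one _).symm)
  have hpow : Tendsto (fun k : ℕ => v ^ ℓ ^ k) atTop (𝓝 1) := tendsto_pi_nhds.2 fun i =>
    tendsto_zero_of_pow_dvd fun k => ⟨v.toAdd i, by
      rw [← Nat.cast_pow, ← nsmul_eq_mul]
      rfl⟩
  simpa only [Function.comp_def, map_pow, map_one] using (continuous_inl.tendsto 1).comp hpow

theorem isLFrattiniCover_padicRed [CompactSpace H] (A : H →* Matrix (Fin t) (Fin t) ℤ_[ℓ]) :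
    IsLFrattiniCover ℓ (padicRed A) where
  surjective := semidirectMap_surjective (ZMod.ringHom_surjective _) A
  eq_top K hK hmap := by
    let L := closedSubmodule (ℓ := ℓ) (K.comap SemidirectProduct.inl).toAddSubgroup'
      (hK.preimage continuous_inl)
    have hL : L = ⊤ := eq_top_of_surjective_mod L fun v => by
      obtain ⟨x, hxK, hx⟩ : padicRed A (.inl (.ofAdd v)) ∈ K.map (padicRed A).toMonoidHom :=
        hmap ▸ Subgroup.mem_top _
      obtain ⟨w, hw, rfl⟩ :=
        exists_inl_of_semidirectMap_eq_inl (hx.trans (semidirectMap_inl _ A _))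
      obtain ⟨u, hu⟩ := exists_eq_smul_of_coordHom_toZMod_eq_one (v := .ofAdd v / w)
        (by rw [map_div, hw, div_self'])
      exact ⟨w.toAdd, hxK, u, by rw [← hu]; simp⟩
    refine eq_top_iff.2 fun x _ => ?_
    obtain ⟨y, hyK, hy⟩ : padicRed A x ∈ K.map (padicRed A).toMonoidHom := hmap ▸ Subgroup.mem_top _
    obtain ⟨v, -, hv⟩ := exists_inl_of_semidirectMap_eq_inl
      (show padicRed A (x / y) = .inl 1 by rw [map_div, map_one, div_eq_one]; exact hy.symm)
    have hvK : v.toAdd ∈ L := hL ▸ Submodule.mem_top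
    rw [← div_mul_cancel x y, ← hv]
    exact mul_mem hvK hyK
  ker_isProL := isProLGroup_of_tendsto ℓ fun x =>
    tendsto_subtype_rng.2 (tendsto_pow_of_padicRed_eq_one A x.2)

end PadicFrattini

section ReductionModuloSquare

variable {ℓ : ℕ} [Fact ℓ.Prime] {t : ℕ} {H : Type u} [Group H]
  (A : H →* Matrix (Fin t) (Fin t) ℤ_[ℓ])

theorem redHom_coordHom_toZModPow (v : Multiplicative (Fin t → ℤ_[ℓ])) :
    redHom ℓ t (coordHom (PadicInt.toZModPow 2) t v) = coordHom PadicInt.toZMod t v :=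
  funext fun i => DFunLike.congr_fun castHom_comp_toZModPow (v.toAdd i)

theorem redHom_matAut (h : H) (v : ZPow (ℓ ^ 2) t) :
    redHom ℓ t (matAut (mapRep (PadicInt.toZModPow 2) A) h v) =
      matAut (mapRep PadicInt.toZMod A) h (redHom ℓ t v) := by
  obtain ⟨v, rfl⟩ := coordHom_surjective (ZMod.ringHom_surjective (PadicInt.toZModPow 2)) v
  rw [← coordHom_matAut, redHom_coordHom_toZModPow, redHom_coordHom_toZModPow, coordHom_matAut]

theorem redMap_semidirectMap (x : PadicSemidirect A) :
    redMap (redHom_matAut A) (semidirectMap (PadicInt.toZModPow 2) A x) =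
      semidirectMap PadicInt.toZMod A x :=
  SemidirectProduct.ext (redHom_coordHom_toZModPow x.left) rfl

theorem isFrattiniCover_redMap [Finite H] : IsFrattiniCover (redMap (redHom_matAut A)) := by
  let _ : TopologicalSpace H := ⊥
  have : DiscreteTopology H := ⟨rfl⟩
  exact (isLFrattiniCover_padicRed A).isFrattiniCover_of_comp
    ⟨semidirectMap (PadicInt.toZModPow 2) A,
      continuous_semidirectMap (isLocallyConstant_toZModPow 2).continuous A⟩
    (semidirectMap_surjective (ZMod.ringHom_surjective _) A) _ (redMap_semidirectMap A)

theorem toZModPow_two_nsmul_eq_zero_iff {x : ℤ_[ℓ]} :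
    PadicInt.toZModPow 2 (ℓ • x) = 0 ↔ PadicInt.toZMod x = 0 := by
  have hℓ : (ℓ : ℤ_[ℓ]) ≠ 0 := Nat.cast_ne_zero.2 (Fact.out : ℓ.Prime).ne_zero
  rw [← RingHom.mem_ker, PadicInt.ker_toZModPow, Ideal.mem_span_singleton, nsmul_eq_mul, pow_two,
    mul_dvd_mul_iff_left hℓ, toZMod_eq_zero_iff_dvd]

theorem coordHom_toZModPow_pow_eq_one_iff {v : Multiplicative (Fin t → ℤ_[ℓ])} :
    coordHom (PadicInt.toZModPow 2) t (v ^ ℓ) = 1 ↔ coordHom PadicInt.toZMod t v = 1 :=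
  funext_iff.trans ((forall_congr' fun _ => toZModPow_two_nsmul_eq_zero_iff).trans
    funext_iff.symm)

theorem nonempty_redSection_equiv :
    Nonempty (Representation.Equiv (sectionRep (redSection (redHom_matAut A)))
      ((matRep (mapRep PadicInt.toZMod A)).comp SemidirectProduct.rightHom)) := by
  let c₂ := coordHom (PadicInt.toZModPow (p := ℓ) 2) t
  have hc₂ : Function.Surjective c₂ := coordHom_surjective (ZMod.ringHom_surjective _)
  let ι : Multiplicative (Fin t → ℤ_[ℓ]) →*
      ZPow (ℓ ^ 2) t ⋊[matAut (mapRep (PadicInt.toZModPow 2) A)] H :=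
    SemidirectProduct.inl.comp (c₂.comp (powMonoidHom ℓ))
  have hι (v) : ι v ∈ (redMap (redHom_matAut A)).ker := by
    refine (SemidirectProduct.map_inl _ _ _ _).trans ?_
    have hpow (w : ZPow ℓ t) : w ^ ℓ = 1 := funext fun i => ZModModule.char_nsmul_eq_zero ℓ _
    rw [MonoidHom.comp_apply, redHom_coordHom_toZModPow, powMonoidHom_apply, map_pow, hpow,
      map_one]
  have hsurj : Function.Surjective (ι.codRestrict _ hι) := by
    rintro ⟨y, hy⟩
    obtain ⟨w, hw, rfl⟩ := redMap_ker _ hy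
    obtain ⟨v, rfl⟩ := hc₂ w
    obtain ⟨u, hu⟩ := exists_eq_smul_of_coordHom_toZMod_eq_one
      ((redHom_coordHom_toZModPow v).symm.trans hw)
    have huv : powMonoidHom ℓ (.ofAdd u) = v :=
      Multiplicative.toAdd.injective (hu.trans (Nat.cast_smul_eq_nsmul _ _ _)).symm
    exact ⟨.ofAdd u, Subtype.ext (congrArg (fun z => SemidirectProduct.inl (c₂ z)) huv)⟩
  have hD (v) : coordHom PadicInt.toZMod t v = 1 ↔ ι v ∈ (⊥ : Subgroup _) := by
    rw [Subgroup.mem_bot, ← coordHom_toZModPow_pow_eq_one_iff]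
    exact (map_eq_one_iff _ SemidirectProduct.inl_injective).symm
  have hconj (x v) : ι (matAut A (SemidirectProduct.rightHom x) v) = x * ι v * x⁻¹ := by
    rw [MonoidHom.comp_apply, MonoidHom.comp_apply, powMonoidHom_apply, ← map_pow]
    exact (congrArg _ (coordHom_matAut _ A _ _)).trans (inl_matAut_eq_conj _ x _)
  obtain ⟨e, -⟩ := exists_sectionRep_equiv (redSection (redHom_matAut A))
    ((matRep (mapRep PadicInt.toZMod A)).comp SemidirectProduct.rightHom) (ι.codRestrict _ hι)
    hsurj (coordHom PadicInt.toZMod t) (coordHom_surjective (ZMod.ringHom_surjective _)) hD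
    fun x v => ⟨_, hconj x v, congrArg _ (coordHom_matAut _ A _ v)⟩
  exact ⟨e⟩

theorem nonempty_redSection_comp_equiv {G : Type v} [Group G]
    (π : G →* ZPow ℓ t ⋊[matAut (mapRep PadicInt.toZMod A)] H) :
    Nonempty (Representation.Equiv
      ((sectionRep (redSection (redHom_matAut A))).comp π : Representation (ZMod ℓ) G _)
      (((matRep (mapRep PadicInt.toZMod A)).comp SemidirectProduct.rightHom).comp π)) := by
  obtain ⟨e⟩ := nonempty_redSection_equiv A
  exact ⟨.mk e.toLinearEquiv fun g => e.isIntertwining' (π g)⟩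

end ReductionModuloSquare

section LatticeReduction

section Cokernels

variable {R : Type*} [Ring R] {X Y Z : Type*} [AddCommGroup X] [AddCommGroup Y] [AddCommGroup Z]
  [Module R X] [Module R Y] [Module R Z]

theorem nonempty_coker_comp_equiv_prod (i : X →ₗ[R] Y) {j : Y →ₗ[R] Z} (hj : Function.Injective j)
    [IsSemisimpleModule R (Z ⧸ (j ∘ₗ i).range)] :
    Nonempty ((Z ⧸ (j ∘ₗ i).range) ≃ₗ[R] (Y ⧸ i.range) × (Z ⧸ j.range)) := by
  let φ : (Y ⧸ i.range) →ₗ[R] Z ⧸ (j ∘ₗ i).range :=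
    Submodule.mapQ _ _ j fun _ ⟨x, hx⟩ => ⟨x, congrArg j hx⟩
  let χ : (Z ⧸ (j ∘ₗ i).range) →ₗ[R] Z ⧸ j.range :=
    Submodule.factor (LinearMap.range_comp_le_range i j)
  have hφ : Function.Injective φ := LinearMap.ker_eq_bot.1 (by
    rw [Submodule.ker_mapQ, LinearMap.range_comp, Submodule.comap_map_eq_of_injective hj,
      Submodule.mkQ_map_self])
  have hχ : Function.Surjective χ := Submodule.factor_surjective _
  have hexact : Function.Exact φ χ := LinearMap.exact_iff.2 (by
    rw [Submodule.ker_mapQ, Submodule.range_mapQ, Submodule.comap_id])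
  obtain ⟨l, hl⟩ := IsSemisimpleModule.extension_property φ hφ LinearMap.id
  exact ⟨(hexact.splitInjectiveEquiv hχ ⟨l, hl⟩).1⟩

theorem nonempty_coker_equiv_coker {i : X →ₗ[R] Y} {j : Y →ₗ[R] X} {f : X →ₗ[R] X}
    {g : Y →ₗ[R] Y} (hf : j ∘ₗ i = f) (hg : i ∘ₗ j = g) (hi : Function.Injective i)
    (hj : Function.Injective j) [IsSemisimpleModule R (X ⧸ f.range)]
    [IsSemisimpleModule R (Y ⧸ g.range)] :
    Nonempty ((X ⧸ f.range) ≃ₗ[R] Y ⧸ g.range) := by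
  subst hf hg
  obtain ⟨e⟩ := nonempty_coker_comp_equiv_prod i hj
  obtain ⟨e'⟩ := nonempty_coker_comp_equiv_prod j hi
  exact ⟨e ≪≫ₗ LinearEquiv.prodComm R _ _ ≪≫ₗ e'.symm⟩

end Cokernels

section Reduction

variable {R : Type*} [Ring R]

/-- The reduction `X / nX` of a module. -/
abbrev ModReduction (R : Type*) [Ring R] (n : ℕ) (X : Type*) [AddCommGroup X] [Module R X] :
    Type _ :=
  X ⧸ (n • LinearMap.id : X →ₗ[R] X).range

variable {n : ℕ} {X : Type*} [AddCommGroup X] [Module R X]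

theorem ModReduction.nsmul_eq_zero (x : ModReduction R n X) : n • x = 0 := by
  obtain ⟨x, rfl⟩ := Submodule.mkQ_surjective _ x
  exact (Submodule.Quotient.mk_eq_zero _).2 ⟨x, rfl⟩

theorem nonempty_modReduction_equiv_of_le
    (hss : ∀ Y : Submodule R X, IsSemisimpleModule R (ModReduction R n Y))
    (hX : Function.Injective fun x : X => n • x) {Y Y' : Submodule R X} (hle : Y ≤ Y')
    (hn : ∀ y ∈ Y', n • y ∈ Y) :
    Nonempty (ModReduction R n Y ≃ₗ[R] ModReduction R n Y') := by
  let j : Y' →ₗ[R] Y := (n • Y'.subtype).codRestrict Y fun y => hn y y.2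
  have hj : Function.Injective j := fun x y hxy => Subtype.ext (hX (congrArg Subtype.val hxy))
  have := hss Y
  have := hss Y'
  exact nonempty_coker_equiv_coker (i := Submodule.inclusion hle) (j := j) rfl rfl
    (Submodule.inclusion_injective hle) hj

theorem nonempty_modReduction_equiv
    (hss : ∀ Y : Submodule R X, IsSemisimpleModule R (ModReduction R n Y))
    (hX : Function.Injective fun x : X => n • x) (m : ℕ) {Y : Submodule R X}
    (hm : ∀ x : X, n ^ m • x ∈ Y) :
    Nonempty (ModReduction R n Y ≃ₗ[R] ModReduction R n X) := by
  induction m generalizing Y with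
  | zero =>
    obtain rfl : Y = ⊤ := eq_top_iff.2 fun x _ => by simpa using hm x
    refine ⟨Submodule.Quotient.equiv _ _ Submodule.topEquiv ?_⟩
    rw [← LinearMap.range_comp, ← LinearMap.range_comp_of_range_eq_top _
      (Submodule.topEquiv (R := R) (M := X)).range]
    rfl
  | succ m ih =>
    let Z : Submodule R X := (n ^ m • LinearMap.id : X →ₗ[R] X).range
    have hn : ∀ y ∈ Y ⊔ Z, n • y ∈ Y := by
      intro y hy
      obtain ⟨y, hyY, _, ⟨x, rfl⟩, rfl⟩ := Submodule.mem_sup.1 hy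
      rw [smul_add]
      refine add_mem (Y.smul_of_tower_mem n hyY) ?_
      change n • n ^ m • x ∈ Y
      rw [smul_smul, ← pow_succ']
      exact hm x
    obtain ⟨e⟩ := nonempty_modReduction_equiv_of_le hss hX le_sup_left hn
    obtain ⟨e'⟩ := ih (Y := Y ⊔ Z) fun x => Submodule.mem_sup_right ⟨x, rfl⟩
    exact ⟨e ≪≫ₗ e'⟩

end Reduction

section PadicReduction

variable {ℓ : ℕ} [Fact ℓ.Prime] {H : Type u} [Group H] [Finite H]

theorem isSemisimpleModule_of_nsmul_eq_zero (hcop : (Nat.card H).Coprime ℓ) {M : Type*}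
    [AddCommGroup M] [Module (MonoidAlgebra ℤ_[ℓ] H) M] (hM : ∀ m : M, ℓ • m = 0) :
    IsSemisimpleModule (MonoidAlgebra ℤ_[ℓ] H) M := by
  have : NeZero (Nat.card H : ZMod ℓ) := ⟨fun h =>
    (Nat.Prime.coprime_iff_not_dvd Fact.out).1 hcop.symm ((ZMod.natCast_eq_zero_iff _ _).1 h)⟩
  let red := MonoidAlgebra.mapRingHom H (PadicInt.toZMod : ℤ_[ℓ] →+* ZMod ℓ)
  have hred : Function.Surjective red :=
    MonoidAlgebra.map_surjective (PadicInt.toZMod : ℤ_[ℓ] →+* ZMod ℓ).toAddMonoidHom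
      (ZMod.ringHom_surjective _)
  have htors : Module.IsTorsionBySet (MonoidAlgebra ℤ_[ℓ] H) M (RingHom.ker red) := by
    rintro m ⟨x, hx⟩
    have hdvd : ∀ h, (ℓ : ℤ_[ℓ]) ∣ x.coeff h := fun h => toZMod_eq_zero_iff_dvd.1 (by
      rw [← MonoidAlgebra.coeff_mapRingHom, show MonoidAlgebra.mapRingHom H _ x = 0 from hx]; rfl)
    choose y hy using hdvd
    have hx : x = ℓ • MonoidAlgebra.ofCoeff (Finsupp.equivFunOnFinite.symm y) := by
      ext h
      rw [hy h, ← nsmul_eq_mul]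
      rfl
    change x • m = 0
    rw [hx, smul_assoc, hM]
  have : IsSemisimpleRing (MonoidAlgebra ℤ_[ℓ] H ⧸ RingHom.ker red) :=
    (RingHom.quotientKerEquivOfSurjective hred).symm.isSemisimpleRing
  let := htors.module
  exact htors.isSemisimpleModule_iff.1 inferInstance

theorem exists_reduction (hcop : (Nat.card H).Coprime ℓ) {V W : Type*} [AddCommGroup V]
    [Module ℤ_[ℓ] V] [AddCommGroup W] (ρ : Representation ℤ_[ℓ] H V)
    (hV : Function.Injective fun v : V => ℓ • v) (q : V →+ W) (hq : Function.Surjective q)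
    (hker : ∀ v, q v = 0 ↔ ∃ u, ℓ • u = v) (L : Subrepresentation ρ) (m : ℕ)
    (hm : ∀ v, ℓ ^ m • v ∈ L) :
    ∃ F : L.toSubmodule →+ W, Function.Surjective F ∧ (∀ y, F y = 0 ↔ ∃ z, ℓ • z = y) ∧
      ∀ h y v, F y = q v → F (L.toRepresentation h y) = q (ρ h v) := by
  obtain ⟨e⟩ := nonempty_modReduction_equiv (R := MonoidAlgebra ℤ_[ℓ] H) (n := ℓ)
    (X := ρ.asModule) (Y := L.asSubmodule)
    (fun Y => isSemisimpleModule_of_nsmul_eq_zero hcop ModReduction.nsmul_eq_zero) hV m hm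
  let q' : ModReduction (MonoidAlgebra ℤ_[ℓ] H) ℓ ρ.asModule →+ W :=
    QuotientAddGroup.lift _ q fun v hv => (hker v).2 hv
  have hq' : Function.Injective q' := (injective_iff_map_eq_zero q').2 fun v hv => by
    obtain ⟨v, rfl⟩ := Submodule.mkQ_surjective _ v
    exact (Submodule.Quotient.mk_eq_zero _).2 ((hker v).1 hv)
  let mkV := (LinearMap.range (ℓ • LinearMap.id : ρ.asModule →ₗ[MonoidAlgebra ℤ_[ℓ] H] _)).mkQ
  let mkL := (LinearMap.range (ℓ • LinearMap.id : L.asSubmodule →ₗ[MonoidAlgebra ℤ_[ℓ] H] _)).mkQ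
  refine ⟨q'.comp (e.toLinearMap ∘ₗ mkL).toAddMonoidHom, ?_, fun y => ?_,
    fun h (y : L.asSubmodule) v hv => ?_⟩
  · have hq'' : Function.Surjective q' := fun w => (hq w).imp' mkV fun _ hv => hv
    exact hq''.comp (e.surjective.comp (Submodule.mkQ_surjective
      (LinearMap.range (ℓ • LinearMap.id : L.asSubmodule →ₗ[MonoidAlgebra ℤ_[ℓ] H] _))))
  · refine (map_eq_zero_iff q' hq').trans ((map_eq_zero_iff e e.injective).trans ?_)
    exact Submodule.Quotient.mk_eq_zero _
  · let s : MonoidAlgebra ℤ_[ℓ] H := MonoidAlgebra.single h 1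
    have hsmul : ∀ v : ρ.asModule, s • v = ρ h v := fun v =>
      (Representation.single_smul ..).trans (one_smul ..)
    have hL : mkL (L.toRepresentation h y) = s • mkL y :=
      (congrArg mkL (Subtype.ext (hsmul y.1).symm)).trans (map_smul mkL s y)
    have hV : mkV (ρ h v) = s • mkV v :=
      (congrArg mkV (hsmul v).symm).trans (map_smul mkV s _)
    have hv' : e (mkL y) = mkV v := hq' hv
    have heq : e (mkL (L.toRepresentation h y)) = mkV (ρ h v) := by
      rw [hL, map_smul, hv', hV]
    exact congrArg q' heq

end PadicReduction

end LatticeReduction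

section LatticeSection

variable {ℓ : ℕ} {A : Type u} {B : Type v} [Group A] [Group B] {p : A →* B}

/-- The `ℓ ^ k`-th power map identifies `L / ℓ L` with `ℓ ^ k L / ℓ ^ (k + 1) L`, because `L` is
torsion-free. -/
theorem nonempty_latticeSection_equiv_of_hom (hp : Function.Surjective p)
    (hc : ∀ x ∈ p.ker, ∀ y ∈ p.ker, x * y = y * x) (htf : Function.Injective fun x : p.ker => x ^ ℓ)
    {V : Type*} [AddCommGroup V] [Module (ZMod ℓ) V] (ρ : Representation (ZMod ℓ) B V)
    (F : p.ker →* Multiplicative V) (hF : Function.Surjective F)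
    (hker : ∀ x, F x = 1 ↔ ∃ z, z ^ ℓ = x)
    (hconj : ∀ a x, (F (MulAut.conjNormal a x)).toAdd = ρ (p a) (F x).toAdd) (k : ℕ) :
    Nonempty (Representation.Equiv (sectionRep (latticeSection ℓ hp hc k)) ρ) := by
  have htfk : Function.Injective fun x : p.ker => x ^ ℓ ^ k := by
    simpa only [pow_iterate] using htf.iterate k
  let g : p.ker →* kerPow p (ℓ ^ k) := MonoidHom.mk'
    (fun x => ⟨(x : A) ^ ℓ ^ k, Subgroup.subset_closure ⟨x, x.2, rfl⟩⟩)
    fun x y => Subtype.ext (Commute.mul_pow (hc x x.2 y y.2) _)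
  have hg : Function.Surjective g := fun z => by
    obtain ⟨x, hx, hxz⟩ := exists_pow_of_mem_kerPow hc z.2
    exact ⟨⟨x, hx⟩, Subtype.ext hxz⟩
  have hmem : ∀ x, F x = 1 ↔ (g x : A) ∈ kerPow p (ℓ ^ (k + 1)) := fun x => by
    rw [hker]
    refine ⟨fun ⟨z, hz⟩ => Subgroup.subset_closure ⟨z, z.2, ?_⟩, fun hx => ?_⟩
    · rw [pow_succ', pow_mul, ← Subgroup.coe_pow, hz]
      rfl
    · obtain ⟨z, hz, hzx⟩ := exists_pow_of_mem_kerPow hc hx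
      refine ⟨⟨z, hz⟩, htfk (Subtype.ext ?_)⟩
      change (z ^ ℓ) ^ ℓ ^ k = _
      rw [← pow_mul, ← pow_succ', hzx]
      rfl
  obtain ⟨e, -⟩ := exists_sectionRep_equiv (latticeSection ℓ hp hc k) ρ g hg F hF hmem fun a x =>
    ⟨MulAut.conjNormal a x, by
      change (a * x * a⁻¹) ^ ℓ ^ k = _
      rw [conj_pow]
      rfl, hconj a x⟩
  exact ⟨e⟩

end LatticeSection

theorem nonempty_continuousMulEquiv_of_bijective {A B : Type*} [Group A] [TopologicalSpace A]
    [CompactSpace A] [Group B] [TopologicalSpace B] [T2Space B] (f : A →ₜ* B)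
    (hf : Function.Bijective f) : Nonempty (A ≃ₜ* B) :=
  let e := MulEquiv.ofBijective f hf
  let e' := Continuous.homeoOfEquivCompactToT2 (f := e.toEquiv) f.continuous_toFun
  ⟨{ e with
    continuous_toFun := e'.continuous
    continuous_invFun := e'.symm.continuous }⟩

instance {A B : Type*} [Group A] [TopologicalSpace A] [CompactSpace A] [Group B]
    [TopologicalSpace B] [T1Space B] (f : A →ₜ* B) : CompactSpace f.toMonoidHom.ker :=
  isCompact_iff_compactSpace.1 (isClosed_singleton.preimage f.continuous_toFun).isCompact

theorem nonempty_linearEquiv_of_smul_mem {R M : Type*} [CommRing R] [IsDomain R]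
    [IsPrincipalIdealRing R] [AddCommGroup M] [Module R M] [Module.Free R M] [Module.Finite R M]
    (L : Submodule R M) {c : R} (hc : c ≠ 0) (hL : ∀ v, c • v ∈ L) : Nonempty (L ≃ₗ[R] M) := by
  refine ⟨LinearEquiv.ofFinrankEq _ _ (le_antisymm ?_ ?_)⟩
  · exact LinearMap.finrank_le_finrank_of_injective L.injective_subtype
  · refine LinearMap.finrank_le_finrank_of_injective
      (f := (LinearMap.lsmul R M c).codRestrict L hL) fun v w hvw => ?_
    exact smul_right_injective M hc (congrArg Subtype.val hvw)

section LatticeCover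

theorem coordHom_toZMod_eq_one_iff {ℓ : ℕ} [Fact ℓ.Prime] {t : ℕ}
    (v : Multiplicative (Fin t → ℤ_[ℓ])) :
    coordHom (PadicInt.toZMod : ℤ_[ℓ] →+* ZMod ℓ) t v = 1 ↔ ∃ u, ℓ • u = v.toAdd := by
  refine ⟨fun hv => ?_, fun ⟨u, hu⟩ => ?_⟩
  · obtain ⟨u, hu⟩ := exists_eq_smul_of_coordHom_toZMod_eq_one hv
    exact ⟨u, (Nat.cast_smul_eq_nsmul _ _ _).symm.trans hu.symm⟩
  · rw [show v = .ofAdd u ^ ℓ from hu.symm, map_pow]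
    change ℓ • (_ : Fin t → ZMod ℓ) = 0
    rw [← Nat.cast_smul_eq_nsmul (ZMod ℓ), CharP.cast_eq_zero, zero_smul]

variable {ℓ : ℕ} [Fact ℓ.Prime] {t : ℕ} {H : Type u} [Group H] [TopologicalSpace H]
  {A : H →* Matrix (Fin t) (Fin t) ℤ_[ℓ]} {G : Type v} [Group G] [TopologicalSpace G]
  {E : Type w} [Group E] [TopologicalSpace E]

/-- A group `E` over `G` that embeds into the fibre product of `ℤ_ℓ ^ t ⋊ H` and `G` over
`(ℤ/ℓ) ^ t ⋊ H` and surjects onto `ℤ_ℓ ^ t ⋊ H`. The kernel of `E → G` then is a sublattice of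
`ℤ_ℓ ^ t`. -/
structure IsLatticeCover (π : G →* ZPow ℓ t ⋊[matAut (mapRep PadicInt.toZMod A)] H)
    (ψ : E →ₜ* G) (β : E →ₜ* PadicSemidirect A) : Prop where
  surjective : Function.Surjective β
  padicRed_apply : ∀ x, padicRed A (β x) = π (ψ x)
  injective : Function.Injective fun x => (β x, ψ x)

namespace IsLatticeCover

variable {π : G →* ZPow ℓ t ⋊[matAut (mapRep PadicInt.toZMod A)] H} {ψ : E →ₜ* G}
  {β : E →ₜ* PadicSemidirect A}

theorem right_apply (h : IsLatticeCover π ψ β) (x : E) : (β x).right = (π (ψ x)).right :=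
  congrArg SemidirectProduct.right (h.padicRed_apply x)

theorem inl_left_apply (h : IsLatticeCover π ψ β) (x : ψ.toMonoidHom.ker) :
    SemidirectProduct.inl (β x).left = β x :=
  SemidirectProduct.ext rfl (by
    rw [h.right_apply, show ψ x = 1 from x.2, map_one]
    rfl)

/-- The embedding of the kernel of a lattice cover into `ℤ_ℓ ^ t`. -/
noncomputable def kerCoord (h : IsLatticeCover π ψ β) :
    ψ.toMonoidHom.ker →* Multiplicative (Fin t → ℤ_[ℓ]) :=
  MonoidHom.mk' (fun x => (β x).left) fun x y => SemidirectProduct.inl_injective (by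
    rw [map_mul, h.inl_left_apply, h.inl_left_apply, h.inl_left_apply, Subgroup.coe_mul, map_mul])

theorem inl_kerCoord (h : IsLatticeCover π ψ β) (x : ψ.toMonoidHom.ker) :
    SemidirectProduct.inl (h.kerCoord x) = β x :=
  h.inl_left_apply x

theorem kerCoord_injective (h : IsLatticeCover π ψ β) : Function.Injective h.kerCoord :=
  fun x y hxy => Subtype.ext (h.injective (Prod.ext
    (by simp only [← h.inl_kerCoord, hxy]) (x.2.trans y.2.symm)))

theorem continuous_kerCoord (h : IsLatticeCover π ψ β) : Continuous h.kerCoord :=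
  continuous_left.comp (β.continuous_toFun.comp continuous_subtype_val)

theorem kerCoord_conj (h : IsLatticeCover π ψ β) (a : E) (x : ψ.toMonoidHom.ker) :
    h.kerCoord (MulAut.conjNormal a x) = matAut A (β a).right (h.kerCoord x) :=
  SemidirectProduct.inl_injective (by
    rw [inl_matAut_eq_conj, h.inl_kerCoord, h.inl_kerCoord, MulAut.conjNormal_apply, map_mul,
      map_mul, map_inv])

theorem mul_comm_of_ker (h : IsLatticeCover π ψ β) :
    ∀ x ∈ ψ.toMonoidHom.ker, ∀ y ∈ ψ.toMonoidHom.ker, x * y = y * x := fun x hx y hy =>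
  congrArg Subtype.val (h.kerCoord_injective (a₁ := ⟨x, hx⟩ * ⟨y, hy⟩) (a₂ := ⟨y, hy⟩ * ⟨x, hx⟩)
    (by rw [map_mul, map_mul, mul_comm]))

theorem injective_pow (h : IsLatticeCover π ψ β) :
    Function.Injective fun x : ψ.toMonoidHom.ker => x ^ ℓ := fun x y hxy =>
  h.kerCoord_injective (smul_right_injective (Fin t → ℤ_[ℓ]) (Fact.out : ℓ.Prime).ne_zero
    ((map_pow h.kerCoord x ℓ).symm.trans
      ((congrArg h.kerCoord hxy).trans (map_pow h.kerCoord y ℓ))))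

variable [CompactSpace E] [T1Space G]

/-- The kernel of a lattice cover, as a stable sublattice of `ℤ_ℓ ^ t`. -/
noncomputable def lattice (h : IsLatticeCover π ψ β) : Subrepresentation (matRep A) where
  toSubmodule := closedSubmodule h.kerCoord.range.toAddSubgroup'
    (isCompact_range h.continuous_kerCoord).isClosed
  apply_mem_toSubmodule g := by
    rintro _ ⟨x, rfl⟩
    obtain ⟨a, ha⟩ := h.surjective (SemidirectProduct.inr g)
    refine ⟨MulAut.conjNormal (H := ψ.toMonoidHom.ker) a x, ?_⟩
    rw [h.kerCoord_conj, ha]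
    rfl

theorem pow_smul_mem_lattice (h : IsLatticeCover π ψ β) {m : ℕ}
    (hm : ∀ g, (π g).right = 1 → g ^ ℓ ^ m = 1) (v : Fin t → ℤ_[ℓ]) : ℓ ^ m • v ∈ h.lattice := by
  obtain ⟨x, hx⟩ := h.surjective (SemidirectProduct.inl (.ofAdd v))
  have hxm : ψ (x ^ ℓ ^ m) = 1 := by
    rw [map_pow, hm _ (by rw [← h.right_apply, hx, SemidirectProduct.right_inl])]
  refine ⟨(⟨x ^ ℓ ^ m, hxm⟩ : ψ.toMonoidHom.ker),
    SemidirectProduct.inl_injective (φ := matAut A) ?_⟩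
  rw [h.inl_kerCoord, map_pow, hx, ← map_pow]
  rfl

/-- The identification of the kernel of a lattice cover with its lattice. -/
noncomputable def kerToLattice (h : IsLatticeCover π ψ β) :
    ψ.toMonoidHom.ker →ₜ* Multiplicative h.lattice.toSubmodule where
  toFun x := .ofAdd ⟨(h.kerCoord x).toAdd, x, rfl⟩
  map_one' := Multiplicative.toAdd.injective (Subtype.ext (map_one h.kerCoord))
  map_mul' x y := Multiplicative.toAdd.injective (Subtype.ext (map_mul h.kerCoord x y))
  continuous_toFun := h.continuous_kerCoord.subtype_mk _

theorem kerToLattice_conj (h : IsLatticeCover π ψ β) (a : E) (x : ψ.toMonoidHom.ker) :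
    (h.kerToLattice (MulAut.conjNormal a x)).toAdd =
      h.lattice.toRepresentation (β a).right (h.kerToLattice x).toAdd :=
  Subtype.ext (h.kerCoord_conj a x)

theorem kerToLattice_surjective (h : IsLatticeCover π ψ β) :
    Function.Surjective h.kerToLattice := by
  rintro ⟨_, x, hx⟩
  exact ⟨x, Subtype.ext hx⟩

theorem nonempty_continuousMulEquiv (h : IsLatticeCover π ψ β) {m : ℕ}
    (hm : ∀ g, (π g).right = 1 → g ^ ℓ ^ m = 1) :
    Nonempty (Multiplicative (Fin t → ℤ_[ℓ]) ≃ₜ* ψ.toMonoidHom.ker) := by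
  obtain ⟨e⟩ := nonempty_linearEquiv_of_smul_mem h.lattice.toSubmodule
    (c := (ℓ : ℤ_[ℓ]) ^ m) (pow_ne_zero m (NeZero.ne _)) fun v => by
      rw [← Nat.cast_pow, Nat.cast_smul_eq_nsmul]
      exact h.pow_smul_mem_lattice hm v
  have he : Continuous e.symm :=
    (h.lattice.toSubmodule.subtype.comp e.symm.toLinearMap).continuous_on_pi.subtype_mk _
  let e' : Multiplicative (Fin t → ℤ_[ℓ]) →ₜ* Multiplicative h.lattice.toSubmodule :=
    ⟨AddMonoidHom.toMultiplicative e.symm.toLinearMap.toAddMonoidHom, he⟩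
  obtain ⟨a⟩ := nonempty_continuousMulEquiv_of_bijective e' e.symm.bijective
  obtain ⟨b⟩ := nonempty_continuousMulEquiv_of_bijective h.kerToLattice
    ⟨fun x y hxy => h.kerCoord_injective (congrArg Subtype.val hxy), h.kerToLattice_surjective⟩
  exact ⟨a.trans b.symm⟩

theorem nonempty_latticeSection_equiv [Finite H] (h : IsLatticeCover π ψ β)
    (hcop : (Nat.card H).Coprime ℓ) (hψ : Function.Surjective ψ) {m : ℕ}
    (hm : ∀ g, (π g).right = 1 → g ^ ℓ ^ m = 1) (k : ℕ) :
    Nonempty (Representation.Equiv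
      (sectionRep (latticeSection ℓ (p := ψ.toMonoidHom) hψ h.mul_comm_of_ker k))
      (((matRep (mapRep PadicInt.toZMod A)).comp SemidirectProduct.rightHom).comp π :
        Representation (ZMod ℓ) G (Fin t → ZMod ℓ))) := by
  let q : (Fin t → ℤ_[ℓ]) →+ (Fin t → ZMod ℓ) :=
    AddMonoidHom.toMultiplicative.symm (coordHom (PadicInt.toZMod : ℤ_[ℓ] →+* ZMod ℓ) t)
  have hq : Function.Surjective q :=
    coordHom_surjective (ZMod.ringHom_surjective (PadicInt.toZMod : ℤ_[ℓ] →+* ZMod ℓ))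
  obtain ⟨F, hF, hFker, hFconj⟩ := exists_reduction hcop (matRep A)
    (smul_right_injective (Fin t → ℤ_[ℓ]) (Fact.out : ℓ.Prime).ne_zero) q hq
    coordHom_toZMod_eq_one_iff h.lattice m (h.pow_smul_mem_lattice hm)
  refine nonempty_latticeSection_equiv_of_hom hψ h.mul_comm_of_ker h.injective_pow _
    (F.toMultiplicative.comp h.kerToLattice.toMonoidHom) (hF.comp h.kerToLattice_surjective)
    (fun x => (hFker _).trans ⟨fun ⟨z, hz⟩ => ?_, fun ⟨z, hz⟩ => ?_⟩) (fun a x => ?_) k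
  · obtain ⟨y, rfl⟩ := h.kerToLattice_surjective (.ofAdd z)
    refine ⟨y, h.kerCoord_injective ?_⟩
    rw [map_pow]
    exact congrArg Subtype.val hz
  · exact ⟨(h.kerToLattice z).toAdd,
      congrArg Multiplicative.toAdd ((map_pow h.kerToLattice z ℓ).symm.trans (congrArg _ hz))⟩
  · obtain ⟨v, hv⟩ := hq (F (h.kerToLattice x).toAdd)
    change F (h.kerToLattice (MulAut.conjNormal a x)).toAdd =
      matRep _ (π (ψ a)).right (F (h.kerToLattice x).toAdd)
    rw [h.kerToLattice_conj, hFconj _ _ v hv.symm, h.right_apply, ← hv]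
    exact coordHom_matAut (PadicInt.toZMod : ℤ_[ℓ] →+* ZMod ℓ) A _ (.ofAdd v)

end IsLatticeCover

end LatticeCover

section Existence

variable {ℓ : ℕ} [Fact ℓ.Prime] {t : ℕ} {G H : Type u} [Group H] [Finite H] [TopologicalSpace H]
  [DiscreteTopology H] {A : H →* Matrix (Fin t) (Fin t) ℤ_[ℓ]} [Group G] [Finite G]
  [TopologicalSpace G] [DiscreteTopology G]

theorem exists_isLatticeCover {π : G →* ZPow ℓ t ⋊[matAut (mapRep PadicInt.toZMod A)] H}
    (hπ : Function.Surjective π) :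
    ∃ (E : ProfiniteGrp.{u}) (ψ : E →ₜ* G) (β : E →ₜ* PadicSemidirect A),
      IsLFrattiniCover ℓ ψ ∧ IsLatticeCover π ψ β := by
  obtain ⟨E, hE, hβ, hcov⟩ := exists_isLFrattiniCover_pullback (ℓ := ℓ) (padicRed A)
    (isLFrattiniCover_padicRed A).surjective (fun x => tendsto_pow_of_padicRed_eq_one A)
    (⟨π, continuous_of_discreteTopology⟩ : G →ₜ* _)
  have : CompactSpace E := isCompact_iff_compactSpace.1 hE.isCompact
  let β : E →ₜ* PadicSemidirect A := restrictHom E (ContinuousMonoidHom.fst _ _)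
  refine ⟨ProfiniteGrp.of E, restrictHom E (ContinuousMonoidHom.snd _ G), β, hcov, ?_,
    fun x => hβ x x.2, Subtype.val_injective⟩
  refine (isLFrattiniCover_padicRed A).surjective_of_comp (θ := β) ?_
  rw [show padicRed A ∘ β = π ∘ restrictHom E (ContinuousMonoidHom.snd _ G) from
    funext fun x => hβ x x.2]
  exact hπ.comp hcov.surjective

end Existence

section FrattiniQuotient

theorem isSimpleGroup_quotient_of_isCoatom {Q : Type*} [Group Q] {M : Subgroup Q} [M.Normal]
    (hM : IsCoatom M) : IsSimpleGroup (Q ⧸ M) where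
  toNontrivial := QuotientGroup.nontrivial_iff.2 hM.1
  eq_bot_or_eq_top_of_normal K _ := by
    have hle : M ≤ K.comap (QuotientGroup.mk' M) := by
      simpa using (QuotientGroup.mk' M).ker_le_comap K
    refine (hM.le_iff.1 hle).symm.imp (fun h => ?_) fun h => ?_
    · rw [← Subgroup.map_comap_eq_self_of_surjective (QuotientGroup.mk'_surjective M) K, h,
        QuotientGroup.map_mk'_self]
    · rw [← Subgroup.map_comap_eq_self_of_surjective (QuotientGroup.mk'_surjective M) K, h,
        ← MonoidHom.range_eq_map, QuotientGroup.range_mk']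

variable {ℓ : ℕ} [Fact ℓ.Prime] {Q : Type*} [Group Q] [Finite Q]

theorem pow_mem_and_commutator_mem_of_isCoatom (hQ : IsPGroup ℓ Q) {M : Subgroup Q}
    (hM : IsCoatom M) : (∀ x, x ^ ℓ ∈ M) ∧ ∀ x y : Q, ⁅x, y⁆ ∈ M := by
  have : Group.IsNilpotent Q := hQ.isNilpotent
  have : M.Normal := Subgroup.NormalizerCondition.normal_of_coatom M
    Group.normalizerCondition_of_isNilpotent hM
  have : IsSimpleGroup (Q ⧸ M) := isSimpleGroup_quotient_of_isCoatom hM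
  have hcomm : ∀ a b : Q ⧸ M, a * b = b * a := IsSimpleGroup.comm_iff_isSolvable.2 inferInstance
  have hcard : Nat.card (Q ⧸ M) = ℓ := by
    let : CommGroup (Q ⧸ M) := { mul_comm := hcomm }
    obtain ⟨k, hk⟩ := IsPGroup.iff_card.1 (hQ.to_quotient M)
    have hprime : (Nat.card (Q ⧸ M)).Prime := IsSimpleGroup.prime_card
    rw [hk] at hprime ⊢
    rw [hprime.eq_one_of_pow, pow_one]
  refine ⟨fun x => (QuotientGroup.eq_one_iff _).1 ?_, fun x y => (QuotientGroup.eq_one_iff _).1 ?_⟩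
  · rw [QuotientGroup.mk_pow, ← hcard, pow_card_eq_one']
  · exact commutatorElement_eq_one_iff_mul_comm.2 (hcomm x y)

theorem frattiniSubgroup_le_map_frattini {G : Type u} [Group G] [TopologicalSpace G]
    [DiscreteTopology G] {N : Subgroup G} [Finite N] (hN : IsPGroup ℓ N) :
    frattiniSubgroup ℓ N ≤ (frattini N).map N.subtype := by
  have hmem : (∀ x : N, x ^ ℓ ∈ frattini N) ∧ ∀ x y : N, ⁅x, y⁆ ∈ frattini N := by
    simp only [frattini, Order.radical, Subgroup.mem_iInf]
    exact ⟨fun x M hM => (pow_mem_and_commutator_mem_of_isCoatom hN hM).1 x,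
      fun x y M hM => (pow_mem_and_commutator_mem_of_isCoatom hN hM).2 x y⟩
  refine Subgroup.topologicalClosure_minimal _ ((Subgroup.closure_le _).2 ?_) (isClosed_discrete _)
  rintro _ (⟨x, hx, rfl⟩ | ⟨x, hx, y, hy, rfl⟩)
  · exact ⟨⟨x, hx⟩ ^ ℓ, hmem.1 _, rfl⟩
  · exact ⟨⁅⟨x, hx⟩, ⟨y, hy⟩⁆, hmem.2 _ _, rfl⟩

theorem closure_eq_top_iff_map_closure_eq_top {Q' : Type*} [Group Q'] {f : Q →* Q'}
    (hf : Function.Surjective f) (hker : f.ker ≤ frattini Q) (S : Set Q) :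
    Subgroup.closure S = ⊤ ↔ Subgroup.closure (f '' S) = ⊤ := by
  rw [← MonoidHom.map_closure]
  refine ⟨fun h => by rw [h, Subgroup.map_top_of_surjective f hf], fun h => ?_⟩
  refine frattini_nongenerating (eq_top_iff.2 ?_)
  rw [← Subgroup.comap_top f, ← h, Subgroup.comap_map_eq]
  exact sup_le_sup_left hker _

theorem closure_eq_top_iff_span_toAdd_eq_top {n : ℕ} {V : Type*} [AddCommGroup V]
    [Module (ZMod n) V] (S : Set (Multiplicative V)) :
    Subgroup.closure S = ⊤ ↔ Submodule.span (ZMod n) (Multiplicative.toAdd '' S) = ⊤ := by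
  let W : AddSubgroup V := AddSubgroup.closure (Multiplicative.toAdd '' S)
  have hspan : Submodule.span (ZMod n) (Multiplicative.toAdd '' S) = W.toZModSubmodule n :=
    le_antisymm (Submodule.span_le.2 AddSubgroup.subset_closure)
      ((AddSubgroup.closure_le _).2 Submodule.subset_span :
        W ≤ (Submodule.span (ZMod n) (Multiplicative.toAdd '' S)).toAddSubgroup)
  have hclosure : Subgroup.closure S = AddSubgroup.toSubgroup W := by
    rw [AddSubgroup.toSubgroup_closure]
    exact congrArg _ (Set.ext fun _ => by simp)
  rw [hspan, hclosure, map_eq_top_iff, map_eq_top_iff]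

theorem rank_eq_finrank_of_ker_le_frattini {V : Type*} [AddCommGroup V] [Module (ZMod ℓ) V]
    {f : Q →* Multiplicative V} (hf : Function.Surjective f) (hker : f.ker ≤ frattini Q) :
    Group.rank Q = Module.finrank (ZMod ℓ) V := by
  classical
  have : Finite V := Finite.of_surjective (Multiplicative.toAdd ∘ f)
    (Multiplicative.toAdd.surjective.comp hf)
  have hspan (S : Set Q) : Subgroup.closure S = ⊤ ↔
      Submodule.span (ZMod ℓ) (Multiplicative.toAdd '' (f '' S)) = ⊤ :=
    (closure_eq_top_iff_map_closure_eq_top hf hker S).trans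
      (closure_eq_top_iff_span_toAdd_eq_top _)
  refine le_antisymm ?_ ?_
  · let b := Module.finBasis (ZMod ℓ) V
    choose x hx using fun i => hf (.ofAdd (b i))
    have hgen : Subgroup.closure ((Finset.univ.image x : Finset Q) : Set Q) = ⊤ := by
      rw [hspan, ← b.span_eq, Finset.coe_image, Finset.coe_univ, Set.image_univ, ← Set.range_comp,
        ← Set.range_comp]
      exact congrArg _ (congrArg Set.range (funext hx))
    refine (Group.rank_le hgen).trans (Finset.card_image_le.trans ?_)
    simp
  · obtain ⟨S, hS, hcl⟩ := Group.rank_spec Q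
    rw [hspan, ← Set.image_comp, ← Finset.coe_image] at hcl
    rw [← hS, ← finrank_top, ← hcl]
    exact (finrank_span_finset_le_card _).trans Finset.card_image_le

end FrattiniQuotient

section CanonicalMap

variable {ℓ t : ℕ}

theorem exists_section_coordinates [Fact ℓ.Prime] {A : Type u} {B : Type v} [Group A] [Group B]
    {p : A →* B} {K D : Subgroup A} (h : IsElemSection ℓ p K D)
    [Module.Finite (ZMod ℓ) (SectionModule h)]
    (ht : Module.finrank (ZMod ℓ) (SectionModule h) = t) :
    ∃ (q : K →* ZPow ℓ t) (M : B →* Matrix (Fin t) (Fin t) (ZMod ℓ)), Function.Surjective q ∧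
      q.ker = D.subgroupOf K ∧ ∀ (a : A) (x : K),
        q ⟨a * x * a⁻¹, h.K_normal.conj_mem _ x.2 a⟩ = matAut M (p a) (q x) := by
  let b := Module.finBasisOfFinrankEq (ZMod ℓ) (SectionModule h) ht
  let e := b.equivFun
  let q : K →* ZPow ℓ t := MonoidHom.mk' (fun x => .ofAdd (e (SectionModule.mk h x)))
    fun x y => congrArg Multiplicative.ofAdd (map_add e (SectionModule.mk h x) (.mk h y))
  refine ⟨q, (LinearMap.toMatrixAlgEquiv b : _ →* _).comp (sectionRep h), fun v => ?_, ?_,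
    fun a x => ?_⟩
  · obtain ⟨x, hx⟩ := SectionModule.exists_mk h (e.symm v.toAdd)
    exact ⟨x, congrArg Multiplicative.ofAdd (by rw [hx, e.apply_symm_apply]; rfl)⟩
  · ext x
    exact (map_eq_zero_iff e e.injective).trans (SectionModule.mk_eq_zero_iff h x)
  · have hrep := (LinearMap.toMatrix_mulVec_repr b b (sectionRep h (p a)) (.mk h x)).symm
    rw [sectionRep_mk] at hrep
    exact congrArg Multiplicative.ofAdd hrep

variable {G : Type u} [Group G]

theorem mulEquivSubgroup_symm_left {N H : Subgroup G} [N.Normal] (hNH : N.IsComplement' H)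
    (n : N) : (SemidirectProduct.mulEquivSubgroup hNH).symm n = SemidirectProduct.inl n :=
  (MulEquiv.symm_apply_eq _).2 (by simp)

theorem mulEquivSubgroup_symm_right {N H : Subgroup G} [N.Normal] (hNH : N.IsComplement' H)
    (h : H) : (SemidirectProduct.mulEquivSubgroup hNH).symm h = SemidirectProduct.inr h :=
  (MulEquiv.symm_apply_eq _).2 (by simp)

/-- The projection of `G = N ⋊ H` onto the complement `H` of the normal subgroup `N`. -/
noncomputable def complementProj {N H : Subgroup G} [N.Normal] (hNH : N.IsComplement' H) : G →* H :=
  SemidirectProduct.rightHom.comp (SemidirectProduct.mulEquivSubgroup hNH).symm.toMonoidHom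

theorem complementProj_apply {N H : Subgroup G} [N.Normal] (hNH : N.IsComplement' H) (h : H) :
    complementProj hNH h = h :=
  congrArg SemidirectProduct.right (mulEquivSubgroup_symm_right hNH h)

theorem ker_complementProj {N H : Subgroup G} [N.Normal] (hNH : N.IsComplement' H) :
    (complementProj hNH).ker = N := by
  rw [complementProj, ← MonoidHom.comap_ker, ← SemidirectProduct.range_inl_eq_ker_rightHom]
  ext g
  refine ⟨fun ⟨n, hn⟩ => ?_, fun hg => ⟨⟨g, hg⟩, (mulEquivSubgroup_symm_left hNH ⟨g, hg⟩).symm⟩⟩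
  rw [← mulEquivSubgroup_symm_left hNH] at hn
  rw [← (SemidirectProduct.mulEquivSubgroup hNH).symm.injective hn]
  exact n.2

variable [TopologicalSpace G] [IsTopologicalGroup G] {N H : Subgroup G}

theorem frattiniSubgroup_le (hN : IsClosed (N : Set G)) : frattiniSubgroup ℓ N ≤ N := by
  refine Subgroup.topologicalClosure_minimal _ ((Subgroup.closure_le _).2 ?_) hN
  rintro _ (⟨x, hx, rfl⟩ | ⟨x, hx, y, hy, rfl⟩)
  · exact pow_mem hx ℓ
  · exact N.commutator_le_self (Subgroup.commutator_mem_commutator hx hy)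

theorem exists_isFrattiniQuotientMap [N.Normal] (hNH : N.IsComplement' H)
    (hN : IsClosed (N : Set G)) {φ : H →* MulAut (ZPow ℓ t)} {q : N →* ZPow ℓ t}
    (hq : Function.Surjective q)
    (hqker : q.ker = (frattiniSubgroup ℓ N).subgroupOf N)
    (hconj : ∀ (h : H) (n : N), q (MulAut.conjNormal (h : G) n) = φ h (q n)) :
    ∃ π : G →* ZPow ℓ t ⋊[φ] H, IsFrattiniQuotientMap N H π := by
  let e := SemidirectProduct.mulEquivSubgroup hNH
  let π : G →* ZPow ℓ t ⋊[φ] H :=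
    (SemidirectProduct.map q (MonoidHom.id H) fun h => by exact MonoidHom.ext (hconj h)).comp
      e.symm.toMonoidHom
  have hπN (n : N) : π n = SemidirectProduct.inl (q n) := by
    rw [MonoidHom.comp_apply, MulEquiv.coe_toMonoidHom, mulEquivSubgroup_symm_left,
      SemidirectProduct.map_inl]
  have hπH (h : H) : π h = SemidirectProduct.inr h := by
    rw [MonoidHom.comp_apply, MulEquiv.coe_toMonoidHom, mulEquivSubgroup_symm_right,
      SemidirectProduct.map_inr, MonoidHom.id_apply]
  have hmem (n : N) : q n = 1 ↔ (n : G) ∈ frattiniSubgroup ℓ N := by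
    rw [← MonoidHom.mem_ker, hqker, Subgroup.mem_subgroupOf]
  refine ⟨π, fun x => ?_, le_antisymm (fun g hg => ?_) fun g hg => ?_, fun n hn => ?_, hπH⟩
  · obtain ⟨n, hn⟩ := hq x.left
    exact ⟨n * x.right, by rw [map_mul, hπN, hπH, hn, SemidirectProduct.inl_left_mul_inr_right]⟩
  · obtain ⟨x, rfl⟩ := e.surjective g
    have hx : SemidirectProduct.inl (q x.left) * SemidirectProduct.inr x.right =
        (1 : _ ⋊[φ] H) := by
      rw [← hπN, ← hπH, ← map_mul]
      exact hg
    have hleft : q x.left = 1 := by simpa using congrArg SemidirectProduct.left hx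
    have hright : x.right = 1 := by simpa using congrArg SemidirectProduct.right hx
    simpa [e, hright] using (hmem _).1 hleft
  · rw [MonoidHom.mem_ker, hπN ⟨g, frattiniSubgroup_le hN hg⟩, (hmem _).2 hg, map_one]
  · rw [hπN ⟨n, hn⟩, SemidirectProduct.right_inl]

end CanonicalMap

section Sylow

theorem coprime_card_of_isComplement' {ℓ : ℕ} [Fact ℓ.Prime] {G : Type u} [Group G] [Finite G]
    {N : Sylow ℓ G} [(N : Subgroup G).Normal] {H : Subgroup G}
    (hNH : (N : Subgroup G).IsComplement' H) :
    (Nat.card H).Coprime ℓ :=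
  hNH.symm.index_eq_card ▸ ((Nat.Prime.coprime_iff_not_dvd Fact.out).2 N.not_dvd_index).symm

variable {ℓ : ℕ} [Fact ℓ.Prime] {t : ℕ} {G : Type u} [Group G] [Finite G] [TopologicalSpace G]
  [DiscreteTopology G] {N : Sylow ℓ G} {H : Subgroup G}

theorem finrank_section_frattiniSubgroup {B : Type v} [Group B] {p : G →* B}
    (h : IsElemSection ℓ p (N : Subgroup G) (frattiniSubgroup ℓ (N : Subgroup G))) :
    Module.finrank (ZMod ℓ) (SectionModule h) = Group.rank N := by
  let f : (N : Subgroup G) →* Multiplicative (SectionModule h) := MonoidHom.mk'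
    (fun x => .ofAdd (.mk h x)) fun x y => congrArg _ (SectionModule.mk_mul h x y)
  refine (rank_eq_finrank_of_ker_le_frattini (f := f) (fun x => ?_) fun x hx => ?_).symm
  · exact SectionModule.exists_mk h x.toAdd
  · obtain ⟨y, hy, hyx⟩ := frattiniSubgroup_le_map_frattini N.isPGroup'
      ((SectionModule.mk_eq_zero_iff h x).1 hx)
    rwa [← Subtype.ext hyx]

theorem exists_sylow_isFrattiniQuotientMap [(N : Subgroup G).Normal]
    (hNH : (N : Subgroup G).IsComplement' H) (ht : Group.rank N = t) :
    ∃ (M : H →* Matrix (Fin t) (Fin t) (ZMod ℓ)) (π : G →* ZPow ℓ t ⋊[matAut M] H),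
      IsFrattiniQuotientMap (N : Subgroup G) H π := by
  let s : G →ₜ* H := ⟨complementProj hNH, continuous_of_discreteTopology⟩
  have hs : ∀ h : H, s h = h := complementProj_apply hNH
  have hsec : IsElemSection ℓ s.toMonoidHom (N : Subgroup G)
      (frattiniSubgroup ℓ (N : Subgroup G)) := by
    rw [← ker_complementProj hNH]
    exact charSection ℓ s fun h => ⟨h, hs h⟩
  have : Finite (SectionModule hsec) := Finite.of_surjective _ (SectionModule.exists_mk hsec)
  obtain ⟨q, M, hq, hqker, hconj⟩ := exists_section_coordinates hsec
    ((finrank_section_frattiniSubgroup hsec).trans ht)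
  refine ⟨M, exists_isFrattiniQuotientMap hNH (isClosed_discrete _) hq hqker fun h n => ?_⟩
  have hconj_h := hconj h n
  rwa [show s.toMonoidHom h = h from hs h] at hconj_h

theorem IsFrattiniQuotientMap.exists_pow_eq_one (hNH : (N : Subgroup G).IsComplement' H)
    {φ : H →* MulAut (ZPow ℓ t)} {π : G →* ZPow ℓ t ⋊[φ] H}
    (hπ : IsFrattiniQuotientMap (N : Subgroup G) H π) :
    ∃ m, ∀ g, (π g).right = 1 → g ^ ℓ ^ m = 1 := by
  obtain ⟨m, hm⟩ := IsPGroup.iff_card.1 N.isPGroup'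
  refine ⟨m, fun g hg => ?_⟩
  obtain ⟨⟨n, h⟩, rfl : (n : G) * (h : G) = g⟩ := hNH.2 g
  have hh : h = 1 := by
    rwa [map_mul, SemidirectProduct.mul_right, hπ.map_N n n.2, hπ.map_H, one_mul] at hg
  have hn : (n : (N : Subgroup G)) ^ ℓ ^ m = 1 := by
    rw [← hm]
    exact pow_card_eq_one'
  simpa [hh] using congrArg Subtype.val hn

end Sylow

section Factorization

theorem isClosed_kerPow {G : Type v} [Group G] [TopologicalSpace G] [T1Space G] {F : Type w}
    [Group F] [TopologicalSpace F] [IsTopologicalGroup F] [CompactSpace F] [T2Space F]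
    {χ : F →ₜ* G} (hc : ∀ x ∈ χ.toMonoidHom.ker, ∀ y ∈ χ.toMonoidHom.ker, x * y = y * x) (n : ℕ) :
    IsClosed (kerPow χ.toMonoidHom n : Set F) := by
  have hker : IsClosed (χ.toMonoidHom.ker : Set F) :=
    isClosed_singleton.preimage χ.continuous_toFun
  have hpow : (kerPow χ.toMonoidHom n : Set F) =
      (fun x => x ^ n) '' (χ.toMonoidHom.ker : Set F) :=
    Set.ext fun _ => ⟨exists_pow_of_mem_kerPow hc, fun hz => Subgroup.subset_closure hz⟩
  rw [hpow]
  exact (hker.isCompact.image (continuous_pow n)).isClosed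

variable {ℓ : ℕ} {G : Type v} [Group G] [TopologicalSpace G] {E : Type u} [Group E]
  [TopologicalSpace E] [IsTopologicalGroup E] {F : Type w} [Group F] [TopologicalSpace F]
  {ψ : E →ₜ* G} {χ : F →ₜ* G} {θ : E →ₜ* F}

theorem exists_abCover_factor [T1Space F]
    (hc : ∀ x ∈ χ.toMonoidHom.ker, ∀ y ∈ χ.toMonoidHom.ker, x * y = y * x) (hθ : χ.comp θ = ψ) :
    ∃ ν : AbCover ψ →ₜ* F, ∀ x : E, ν (QuotientGroup.mk x) = θ x := by
  have hker : ∀ x ∈ ψ.toMonoidHom.ker, θ x ∈ χ.toMonoidHom.ker := fun x hx =>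
    (DFunLike.congr_fun hθ x).trans hx
  have hle : kerCommutator ψ ≤ θ.toMonoidHom.ker := by
    refine Subgroup.topologicalClosure_minimal _ (Subgroup.commutator_le.2 fun x hx y hy => ?_)
      (isClosed_singleton.preimage θ.continuous_toFun)
    rw [MonoidHom.mem_ker, map_commutatorElement, commutatorElement_eq_one_iff_mul_comm]
    exact hc _ (hker x hx) _ (hker y hy)
  exact ⟨⟨QuotientGroup.lift (kerCommutator ψ) θ.toMonoidHom hle,
    θ.continuous_toFun.quotient_lift _⟩, fun x => rfl⟩

variable [IsTopologicalGroup F] [CompactSpace F] [T2Space F] [T1Space G]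

theorem frattiniSubgroup_ker_le_comap_kerPow
    (hc : ∀ x ∈ χ.toMonoidHom.ker, ∀ y ∈ χ.toMonoidHom.ker, x * y = y * x) (hθ : χ.comp θ = ψ) :
    frattiniSubgroup ℓ ψ.toMonoidHom.ker ≤ (kerPow χ.toMonoidHom ℓ).comap θ.toMonoidHom := by
  have hker : ∀ x ∈ ψ.toMonoidHom.ker, θ x ∈ χ.toMonoidHom.ker := fun x hx =>
    (DFunLike.congr_fun hθ x).trans hx
  refine Subgroup.topologicalClosure_minimal _ ((Subgroup.closure_le _).2 ?_)
    ((isClosed_kerPow hc _).preimage θ.continuous_toFun)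
  rintro _ (⟨x, hx, rfl⟩ | ⟨x, hx, y, hy, rfl⟩)
  · exact Subgroup.subset_closure ⟨θ x, hker x hx, (map_pow θ x ℓ).symm⟩
  · have hcomm : θ ⁅x, y⁆ = 1 := by
      rw [map_commutatorElement, commutatorElement_eq_one_iff_mul_comm]
      exact hc _ (hker x hx) _ (hker y hy)
    exact Subgroup.mem_comap.2 (hcomm ▸ one_mem _)

theorem exists_charRep_intertwiningMap (hψ : Function.Surjective ψ) (hχ : Function.Surjective χ)
    (hc : ∀ x ∈ χ.toMonoidHom.ker, ∀ y ∈ χ.toMonoidHom.ker, x * y = y * x)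
    (hθ : χ.comp θ = ψ) (hθ_surj : Function.Surjective θ) :
    ∃ f : Representation.IntertwiningMap (charRep ℓ ψ hψ)
        (sectionRep (latticeSection ℓ (p := χ.toMonoidHom) hχ hc 0)),
      Function.Surjective f ∧
        ∀ (x : ψ.toMonoidHom.ker) (hx : θ x ∈ kerPow χ.toMonoidHom (ℓ ^ 0)),
          f (SectionModule.mk _ x) = SectionModule.mk _ ⟨θ x, hx⟩ := by
  obtain ⟨f, hf⟩ := exists_sectionRep_intertwiningMap (charSection ℓ ψ hψ)
    (latticeSection ℓ (p := χ.toMonoidHom) hχ hc 0) θ.toMonoidHom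
    (congrArg ContinuousMonoidHom.toMonoidHom hθ)
    (fun x hx => mem_kerPow_pow_zero ℓ ((DFunLike.congr_fun hθ x).trans hx))
    (by simpa using frattiniSubgroup_ker_le_comap_kerPow hc hθ)
  refine ⟨f, fun v => ?_, fun x _ => hf x⟩
  obtain ⟨⟨y, hy⟩, rfl⟩ := SectionModule.exists_mk _ v
  obtain ⟨x, rfl⟩ := hθ_surj y
  have hx : ψ x = 1 := (DFunLike.congr_fun hθ x).symm.trans (kerPow_le χ.toMonoidHom _ hy)
  exact ⟨_, hf ⟨x, hx⟩⟩

end Factorization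

section Lift

variable {ℓ : ℕ} [Fact ℓ.Prime] {t : ℕ} {H : Type u} [Group H] [TopologicalSpace H]
  [DiscreteTopology H] (A : H →* Matrix (Fin t) (Fin t) ℤ_[ℓ])

theorem exists_lift_redMap {E : Type v} [Group E] [TopologicalSpace E]
    {β : E →ₜ* PadicSemidirect A} (hβ : Function.Surjective β)
    {χ : E →* ZPow ℓ t ⋊[matAut (mapRep PadicInt.toZMod A)] H} (hχ : ∀ x, padicRed A (β x) = χ x) :
    ∃ θ : E →* ZPow (ℓ ^ 2) t ⋊[matAut (mapRep (PadicInt.toZModPow 2) A)] H,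
      IsOpen (θ.ker : Set E) ∧ Function.Surjective θ ∧ (redMap (redHom_matAut A)).comp θ = χ := by
  let ρ := semidirectMap (PadicInt.toZModPow 2) A
  have hρ : Continuous ρ := continuous_semidirectMap (isLocallyConstant_toZModPow 2).continuous A
  refine ⟨ρ.comp β.toMonoidHom,
    (isOpen_discrete {1}).preimage (hρ.comp β.continuous_toFun),
    (semidirectMap_surjective (ZMod.ringHom_surjective _) A).comp hβ, ?_⟩
  ext1 x
  exact (redMap_semidirectMap A (β x)).trans (hχ x)

end Lift

end LFrattini

open LFrattini in
theorem mainTheorem5 (ℓ : ℕ) [Fact ℓ.Prime] {G : Type u} [Group G] [Finite G]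
    [TopologicalSpace G] [DiscreteTopology G]
    (N : Sylow ℓ G) [(N : Subgroup G).Normal] (H : Subgroup G)
    (hNH : (N : Subgroup G).IsComplement' H) (t : ℕ) (ht : Group.rank N = t) :
    -- `G` has a universal `ℓ`-Frattini cover
    (∃ (E : ProfiniteGrp.{u}) (ψ : E →ₜ* G), IsUniversalLFrattiniCover ℓ ψ) ∧
    -- the map `π : G → (ℤ/ℓ)^t ⋊ H`, the cover `μ = redMap hφ`, and the module `M' = (ℤ/ℓ)^t`
    ∃ (φ₁ : H →* MulAut (ZPow ℓ t)) (π : G →* ZPow ℓ t ⋊[φ₁] H)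
      (φ₂ : H →* MulAut (ZPow (ℓ ^ 2) t))
      (hφ : ∀ g v, redHom ℓ t (φ₂ g v) = φ₁ g (redHom ℓ t v))
      (M' : Representation (ZMod ℓ) G (Fin t → ZMod ℓ)),
      IsFrattiniQuotientMap (N : Subgroup G) H π ∧
      IsFrattiniCover (redMap hφ) ∧
      -- `ker μ = M'` as a `ℤ/ℓ[G]`-module, `G` acting through `π`
      Nonempty (Representation.Equiv
        ((sectionRep (redSection hφ)).comp π : Representation (ZMod ℓ) G _) M') ∧
      ∀ (E : ProfiniteGrp.{u}) (ψ : E →ₜ* G) (hψ : IsUniversalLFrattiniCover ℓ ψ),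
        -- `μ' = π ∘ ψ` extends to a continuous surjection onto `(ℤ/ℓ²)^t ⋊ H`
        (∃ θ : E →* ZPow (ℓ ^ 2) t ⋊[φ₂] H, IsOpen (θ.ker : Set E) ∧ Function.Surjective θ ∧
          (redMap hφ).comp θ = π.comp ψ.toMonoidHom) ∧
        -- `M'` is a quotient of the characteristic module
        ∃ f : Representation.IntertwiningMap
            (charRep ℓ ψ hψ.isLFrattiniCover.surjective) M', Function.Surjective f ∧
        -- a lattice quotient `L → G⋆ → G` of the abelianized cover, with `L = ℤ_ℓ^t`
        ∃ (Gs : ProfiniteGrp.{u}) (ψs : Gs →ₜ* G) (hs : IsLFrattiniCover ℓ ψs)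
          (hc : ∀ x ∈ ψs.toMonoidHom.ker, ∀ y ∈ ψs.toMonoidHom.ker, x * y = y * x)
          (ν : AbCover ψ →ₜ* Gs) (hν : ∀ x : E, ψs (ν (QuotientGroup.mk x)) = ψ x),
          Function.Surjective ν ∧
          Nonempty (Multiplicative (Fin t → ℤ_[ℓ]) ≃ₜ* ψs.toMonoidHom.ker) ∧
          -- `ℓ^k L / ℓ^(k+1) L = M'` for all `k`
          (∀ k : ℕ, Nonempty (Representation.Equiv
            (sectionRep (latticeSection ℓ hs.surjective hc k)) M')) ∧
          -- the map on `L / ℓ L` induced by `ν` is the quotient map `f`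
          ∃ r : Representation.Equiv (sectionRep (latticeSection ℓ hs.surjective hc 0)) M',
            ∀ x : ψ.toMonoidHom.ker,
              r (SectionModule.mk _ ⟨ν (QuotientGroup.mk (x : E)),
                mem_kerPow_pow_zero ℓ (MonoidHom.mem_ker.2 ((hν x).trans x.2))⟩) =
              f (SectionModule.mk _ x) := by
  refine ⟨exists_isUniversalLFrattiniCover ℓ G, ?_⟩
  have hcop : (Nat.card H).Coprime ℓ := coprime_card_of_isComplement' hNH
  obtain ⟨M, π, hπ⟩ := exists_sylow_isFrattiniQuotientMap hNH ht
  obtain ⟨A, rfl⟩ := exists_padic_lift hcop M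
  obtain ⟨m, hm⟩ := hπ.exists_pow_eq_one hNH
  obtain ⟨Gs, ψs, β, hcov, hlat⟩ := exists_isLatticeCover hπ.surjective
  have hlattice := hlat.nonempty_latticeSection_equiv hcop hcov.surjective hm
  obtain ⟨r⟩ := hlattice 0
  refine ⟨_, π, _, redHom_matAut A, _, hπ, isFrattiniCover_redMap A,
    nonempty_redSection_comp_equiv A π, fun E ψ hψ => ?_⟩
  obtain ⟨θ, hθ⟩ := hψ.exists_factor Gs ψs hcov
  have hθ_apply (x : E) : ψs (θ x) = ψ x := DFunLike.congr_fun hθ x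
  have hψ_surj := hψ.isLFrattiniCover.surjective
  have hθ_surj := hcov.surjective_of_comp θ (by rwa [show ψs ∘ θ = ψ from funext hθ_apply])
  obtain ⟨f, hf, hfθ⟩ := exists_charRep_intertwiningMap hψ_surj hcov.surjective
    hlat.mul_comm_of_ker hθ hθ_surj
  obtain ⟨ν, hν⟩ := exists_abCover_factor hlat.mul_comm_of_ker hθ
  refine ⟨exists_lift_redMap A (β := β.comp θ) (hlat.surjective.comp hθ_surj) fun x => ?_,
    r.toIntertwiningMap.comp f, r.surjective.comp hf, Gs, ψs, hcov, hlat.mul_comm_of_ker, ν,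
    fun x => (congrArg ψs (hν x)).trans (hθ_apply x), fun y => ?_,
    hlat.nonempty_continuousMulEquiv hm, hlattice, r, fun x => ?_⟩
  · exact (hlat.padicRed_apply (θ x)).trans (congrArg π (hθ_apply x))
  · exact (hθ_surj y).imp' QuotientGroup.mk fun x hx => (hν x).trans hx
  · exact congrArg r ((congrArg (SectionModule.mk _) (Subtype.ext (hν x))).trans (hfθ x
      (mem_kerPow_pow_zero ℓ ((hθ_apply x).trans x.2))).symm)
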